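/- **Corollary 2.** Let $p\ge 0$, and let $P_k$ denote the Legendre polynomials on $[-1,1]$ with $P_k(1)=1$. Put $R=P_{p+1}-P_p$, $$f(z,\xi)=\frac{(-1)^{p+1}}{2}\sum_{k=1}^{p+1}2^k z^{p+1-k}R^{(k)}(\xi),\qquad g(z)=z^{p+1}+f(z,-1).$$ Call the non-zero roots of the polynomial $g(z)-f(z,1)$ the *non-physical roots*. Then every non-physical root has positive real part. Moreover, let $\mu>0$ be any number with $\mu\le\operatorname{Re} z$ for every non-physical root $z$ (for instance, if $p\ge1$, the smallest such real part). Then the following holds. Let $a,L>0$, $x_0\in\mathbb R$, and let $u_0:\mathbb R\to\mathbb C$ be smooth and $L$-periodic (the initial profile of the solution of $u_t+au_x=0$). For $N\ge1$ put $h=L/N$, $x_j=x_0+jh$ $(j\in\mathbb Z)$, and $u_j(\xi)=u_0\big(x_j+\tfrac h2(\xi+1)\big)$ for $\xi\in[-1,1]$. For each $N$ let $U_j(\cdot,t)$ $(j\in\mathbb Z,\ t\ge0)$ be the semi-discrete discontinuous Galerkin solution of degree $p$ with upwind flux on this uniform periodic mesh: $U_j(\cdot,t)$ is a polynomial of degree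 at most $p$, $U_{j+N}=U_j$, and for every polynomial $V$ of degree at most $p$, all $j$ and all $t\ge0$, $$\frac{d}{dt}\int_{-1}^1U_jV\,d\xi+\frac{2a}{h}\big[U_j(1,t)V(1)-U_{j-1}(1,t)V(-1)\big]-\frac{2a}{h}\int_{-1}^1U_jV'\,d\xi=0 .$$ Suppose that the initial data are obtained by the same linear projection on all cells, $U_j(\cdot,0)=Q_N(u_j)$, where $Q_N$ is a linear map from smooth functions on $[-1,1]$ to polynomials of degree at most $p$ with $\sup_{[-1,1]}|Q_Nv|\le BN^s\max_{i\le r}\sup_{[-1,1]}|v^{(i)}|$ for constants $B,r,s$ independent of $N$, and suppose that for some $C_0$, all $N\ge 1$, all $j$ and $k=0,\dots,p$, $$\Big|\int_{-1}^1\big[U_j(\xi,0)-u_j(\xi)\big]P_k(\xi)\,d\xi\Big|\le C_0h^{2p+1-k}.$$ Then, once the non-physical modes have been damped out to order $h^{2p+1}$, the numerical solution is advected with error of order $2p+1$: for every $M$ there is a constant $K$, independent of $N$, $t$, $j$ and $\xi$, such that for all $N\ge1$ and all $t\ge0$ with $e^{-a\mu t/h}\le M h^{2p+1}$, $$\big|U_{j+1}(\xi,t+h/a)-U_j(\xi,t)\big|\le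 K\,h^{2p+1}\qquad\text{for all } j \text{ and all } \xi\in[-1,1].$$ -/

import Mathlib

open Polynomial
open scoped ContDiff

noncomputable section

namespace DGAdvection

/-- The Legendre polynomial `P_k` on `[-1,1]` (Rodrigues' formula, normalised by `P_k(1) = 1`). -/
def legendre (k : ℕ) : ℂ[X] :=
  C ((2 ^ k * (k.factorial : ℂ))⁻¹) * derivative^[k] ((X ^ 2 - 1) ^ k)

/-- The right Radau polynomial `R⁻_{p+1} = P_{p+1} - P_p`. -/
def radau (p : ℕ) : ℂ[X] := legendre (p + 1) - legendre p

/-- `f(z,ξ) = ((-1)^{p+1}/2) ∑_{k=1}^{p+1} 2^k z^{p+1-k} (d^k/dξ^k) R⁻_{p+1}(ξ)`. -/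
def fPoly (p : ℕ) (z ξ : ℂ) : ℂ :=
  (-1) ^ (p + 1) / 2 *
    ∑ k ∈ Finset.Icc 1 (p + 1), 2 ^ k * z ^ (p + 1 - k) * (derivative^[k] (radau p)).eval ξ

/-- `g(z) = z^{p+1} + ((-1)^{p+1}/2) ∑_{k=1}^{p+1} 2^k z^{p+1-k} (d^k/dξ^k) R⁻_{p+1}(-1)`;
`f(z,1)/g(z)` is the `p/(p+1)` Padé approximant of `e^z`. -/
def gPoly (p : ℕ) (z : ℂ) : ℂ := z ^ (p + 1) + fPoly p z (-1)

/-- The non-zero roots `μ_m` of `g(z) - f(z,1)`: the leading coefficients of the non-physical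
numerical frequencies `ω_m = μ_m / h + O(1)`, whose modes behave in time like `e^{-a μ_m t / h}`. -/
def IsNonphysicalRoot (p : ℕ) (z : ℂ) : Prop := z ≠ 0 ∧ gPoly p z - fPoly p z 1 = 0

/-- The function `u` on the cell `[x₀ + j h, x₀ + (j+1) h]`, mapped to the canonical element
`[-1,1]`. -/
def onCell (u : ℝ → ℂ) (x₀ h : ℝ) (j : ℤ) (ξ : ℝ) : ℂ := u (x₀ + j * h + h / 2 * (ξ + 1))

/-- `U j t` (a polynomial in the canonical variable `ξ ∈ [-1,1]`) is the semi-discrete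
discontinuous Galerkin solution of degree `p` with upwind flux of `u_t + a u_x = 0` on a uniform
periodic mesh of `N` cells of size `h`; cells are indexed by `j : ℤ` modulo `N`. -/
structure IsDGSolution (p : ℕ) (a h : ℝ) (N : ℕ) (U : ℤ → ℝ → ℂ[X]) : Prop where
  natDegree_le : ∀ (j : ℤ) (t : ℝ), 0 ≤ t → (U j t).natDegree ≤ p
  periodic : ∀ (j : ℤ) (t : ℝ), 0 ≤ t → U (j + N) t = U j t
  weak_form : ∀ (j : ℤ) (t : ℝ), 0 ≤ t → ∀ V : ℂ[X], V.natDegree ≤ p →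
    HasDerivWithinAt
      (fun s : ℝ => ∫ ξ in (-1 : ℝ)..1, (U j s).eval (ξ : ℂ) * V.eval (ξ : ℂ))
      ((2 * a / h : ℝ) *
          (∫ ξ in (-1 : ℝ)..1, (U j t).eval (ξ : ℂ) * (derivative V).eval (ξ : ℂ))
        - (2 * a / h : ℝ) *
          ((U j t).eval 1 * V.eval 1 - (U (j - 1) t).eval 1 * V.eval (-1)))
      (Set.Ici 0) t

/-- `Q` is a linear operator from smooth functions on the canonical element `[-1,1]` to
polynomials of degree at most `p`, bounded by `B` from the `C^r`-norm to the sup-norm on `[-1,1]`.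
The bound makes `Q v` depend on `v` only through its restriction to `[-1,1]`. -/
structure IsCellProjection (p r : ℕ) (B : ℝ) (Q : (ℝ → ℂ) → ℂ[X]) : Prop where
  natDegree_le : ∀ v : ℝ → ℂ, ContDiff ℝ ∞ v → (Q v).natDegree ≤ p
  map_add : ∀ v w : ℝ → ℂ, ContDiff ℝ ∞ v → ContDiff ℝ ∞ w →
    Q (fun ξ => v ξ + w ξ) = Q v + Q w
  map_smul : ∀ (c : ℂ) (v : ℝ → ℂ), ContDiff ℝ ∞ v → Q (fun ξ => c * v ξ) = C c * Q v
  bound : ∀ v : ℝ → ℂ, ContDiff ℝ ∞ v → ∀ b : ℝ,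
    (∀ i ≤ r, ∀ ξ ∈ Set.Icc (-1 : ℝ) 1, ‖iteratedDeriv i v ξ‖ ≤ b) →
      ∀ ξ ∈ Set.Icc (-1 : ℝ) 1, ‖(Q v).eval (ξ : ℂ)‖ ≤ B * b

end DGAdvection

end

/-
The discrete Fourier transform in the cell index turns the scheme, in the time `τ = a t / h`, into
one linear system `x' = A(θ) x` on polynomials of degree at most `p` for each grid angle
`θ = 2πn/N`, and the error of advection by one cell into the defect `e^{A(θ)} x - e^{-iθ} x`.

Evaluation at the inflow end is represented by the derivative of the Radau polynomial `R`. Hence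
`f(iθ, ·)` is an eigenvector of `A(θ)` for the exact eigenvalue `-iθ` up to a multiple of the
residual `g(iθ) - e^{-iθ} f(iθ, 1)`, which is `O(θ^(2p+2))` because `R` is orthogonal to the
polynomials of degree below `p`: `f(z, 1) / g(z)` is a Padé approximant of `e^z`. Since `A(θ)` is
dissipative, this residual also bounds the error of the flow on that mode, for all times.
Since `A(θ)` is symmetric for the bilinear form `∫ x(-ξ) y(ξ) dξ`, the mode yields a left
eigenfunctional up to the same residual, which splits off a complement. At `θ = 0` the spectrum
on the complement consists of the negatives of the non-physical roots, so for small `θ` the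
complement decays like `e^{-ντ}` for every `ν < μ`.

The grid modes of smooth data are summable with powers of `θ / h`, so the slow parts add up to
`O(h^(2p+1))`. The moment condition bounds the fast part of the data, mode by mode, by `O(h)`, and
the sum over the modes by `O(√h)`; this spare factor pays for the loss of rate from `μ` to `ν`.
-/

noncomputable section

namespace DGAdvection

/-! ### Integration over the canonical element -/

theorem continuous_eval_ofReal (P : ℂ[X]) : Continuous fun ξ : ℝ => P.eval (ξ : ℂ) :=
  P.continuous.comp Complex.continuous_ofReal

/-- The linear functional `P ↦ ∫ P` over the canonical element `[-1,1]`. -/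
def cellIntegral : ℂ[X] →ₗ[ℂ] ℂ where
  toFun P := ∫ ξ in (-1 : ℝ)..1, P.eval (ξ : ℂ)
  map_add' P Q := by
    simp only [eval_add]
    exact intervalIntegral.integral_add ((continuous_eval_ofReal P).intervalIntegrable _ _)
      ((continuous_eval_ofReal Q).intervalIntegrable _ _)
  map_smul' c P := by simp [eval_smul]

theorem cellIntegral_apply (P : ℂ[X]) : cellIntegral P = ∫ ξ in (-1 : ℝ)..1, P.eval (ξ : ℂ) := rfl

theorem cellIntegral_mul (P Q : ℂ[X]) :
    cellIntegral (P * Q) = ∫ ξ in (-1 : ℝ)..1, P.eval (ξ : ℂ) * Q.eval (ξ : ℂ) := by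
  simp only [cellIntegral_apply, eval_mul]

theorem cellIntegral_C_mul (c : ℂ) (P : ℂ[X]) : cellIntegral (C c * P) = c * cellIntegral P := by
  rw [← smul_eq_C_mul, map_smul, smul_eq_mul]

theorem hasDerivAt_eval_ofReal (P : ℂ[X]) (x : ℝ) :
    HasDerivAt (fun ξ : ℝ => P.eval (ξ : ℂ)) ((derivative P).eval (x : ℂ)) x :=
  (P.hasDerivAt (x : ℂ)).comp_ofReal

theorem cellIntegral_derivative (P : ℂ[X]) :
    cellIntegral (derivative P) = P.eval 1 - P.eval (-1) := by
  rw [cellIntegral_apply, intervalIntegral.integral_eq_sub_of_hasDerivAt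
    (fun x _ => hasDerivAt_eval_ofReal P x) ((continuous_eval_ofReal _).intervalIntegrable _ _)]
  simp

theorem cellIntegral_derivative_mul (P Q : ℂ[X]) :
    cellIntegral (derivative P * Q) =
      P.eval 1 * Q.eval 1 - P.eval (-1) * Q.eval (-1) - cellIntegral (P * derivative Q) := by
  rw [eq_sub_iff_add_eq, ← map_add, ← derivative_mul, cellIntegral_derivative, eval_mul, eval_mul]

theorem cellIntegral_comp_neg (P : ℂ[X]) : cellIntegral (P.comp (-X)) = cellIntegral P := by
  simpa [cellIntegral_apply] using intervalIntegral.integral_comp_neg (a := -1) (b := 1)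
    fun ξ : ℝ => P.eval (ξ : ℂ)

/-! ### Legendre and Radau polynomials -/

theorem eval_iterate_derivative_X_sub_C_pow_mul (x : ℂ) (k : ℕ) (Q : ℂ[X]) :
    (derivative^[k] ((X - C x) ^ k * Q)).eval x = k.factorial * Q.eval x := by
  rw [← coe_aeval_eq_eval, aeval_iterate_derivative_self _ k x (p' := Q) (by simp), nsmul_eq_mul,
    coe_aeval_eq_eval]

theorem legendre_eval_one (k : ℕ) : (legendre k).eval 1 = 1 := by
  have factor : ((X : ℂ[X]) ^ 2 - 1) ^ k = (X - C 1) ^ k * (X + 1) ^ k := by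
    rw [← mul_pow, C_1]
    ring
  have : (k.factorial : ℂ) ≠ 0 := mod_cast k.factorial_ne_zero
  rw [legendre, eval_mul, factor, eval_iterate_derivative_X_sub_C_pow_mul, eval_C, eval_pow,
    eval_add, eval_X, eval_one, one_add_one_eq_two]
  field_simp

theorem legendre_eval_neg_one (k : ℕ) : (legendre k).eval (-1) = (-1) ^ k := by
  have factor : ((X : ℂ[X]) ^ 2 - 1) ^ k = (X - C (-1)) ^ k * (X - 1) ^ k := by
    rw [← mul_pow, C_neg, C_1]
    ring
  have : (k.factorial : ℂ) ≠ 0 := mod_cast k.factorial_ne_zero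
  have pow_neg_two : ((-1 : ℂ) - 1) ^ k = (-1) ^ k * 2 ^ k := by rw [← mul_pow]; norm_num
  rw [legendre, eval_mul, factor, eval_iterate_derivative_X_sub_C_pow_mul, eval_C, eval_pow,
    eval_sub, eval_X, eval_one, pow_neg_two]
  field_simp

theorem natDegree_X_sq_sub_one_pow (k : ℕ) : (((X : ℂ[X]) ^ 2 - 1) ^ k).natDegree = 2 * k := by
  rw [natDegree_pow, ← C_1, natDegree_X_pow_sub_C, mul_comm]

theorem natDegree_legendre_le (k : ℕ) : (legendre k).natDegree ≤ k := by
  refine (natDegree_C_mul_le _ _).trans ((natDegree_iterate_derivative _ _).trans ?_)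
  rw [natDegree_X_sq_sub_one_pow]
  omega

theorem coeff_legendre_ne_zero (k : ℕ) : (legendre k).coeff k ≠ 0 := by
  have leading : (((X : ℂ[X]) ^ 2 - 1) ^ k).coeff (k + k) = 1 := by
    have monic : (((X : ℂ[X]) ^ 2 - 1) ^ k).Monic := by
      simpa using (monic_X_pow_sub_C (1 : ℂ) two_ne_zero).pow k
    rw [← two_mul, ← natDegree_X_sq_sub_one_pow, monic.coeff_natDegree]
  rw [legendre, coeff_C_mul, coeff_iterate_derivative, leading]
  simp [k.factorial_ne_zero]

theorem degree_legendre (k : ℕ) : (legendre k).degree = k :=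
  degree_eq_of_le_of_coeff_ne_zero (natDegree_le_iff_degree_le.1 (natDegree_legendre_le k))
    (coeff_legendre_ne_zero k)

theorem eval_iterate_derivative_pow_eq_zero {P : ℂ[X]} {x : ℂ} (hx : P.eval x = 0) {j k : ℕ}
    (hjk : j < k) : (derivative^[j] (P ^ k)).eval x = 0 := by
  obtain ⟨Q, hQ⟩ := pow_sub_dvd_iterate_derivative_pow P k j
  rw [hQ, eval_mul, eval_pow, hx, zero_pow (by omega), zero_mul]

theorem cellIntegral_iterate_derivative_mul_eq_zero {j k : ℕ} (hjk : j ≤ k) (V : ℂ[X])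
    (hV : V.degree < j) :
    cellIntegral (derivative^[j] ((X ^ 2 - 1) ^ k) * V) = 0 := by
  induction j generalizing V with
  | zero => simp [show V = 0 by simpa using hV]
  | succ j ih =>
    have hV' : (derivative V).degree < j := by
      rcases eq_or_ne V 0 with rfl | hne
      · simp
      · exact (degree_derivative_lt hne).trans_le (Order.le_of_lt_succ hV)
    rw [Function.iterate_succ_apply', cellIntegral_derivative_mul, ih (by omega) _ hV',
      eval_iterate_derivative_pow_eq_zero (by simp) hjk,
      eval_iterate_derivative_pow_eq_zero (by simp) hjk]
    ring

theorem cellIntegral_legendre_mul_eq_zero (k : ℕ) (V : ℂ[X]) (hV : V.degree < k) :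
    cellIntegral (legendre k * V) = 0 := by
  rw [legendre, mul_assoc, cellIntegral_C_mul,
    cellIntegral_iterate_derivative_mul_eq_zero le_rfl V hV, mul_zero]

theorem radau_eval_one (p : ℕ) : (radau p).eval 1 = 0 := by
  simp [radau, legendre_eval_one]

theorem radau_eval_neg_one (p : ℕ) : (radau p).eval (-1) = 2 * (-1) ^ (p + 1) := by
  rw [radau, eval_sub, legendre_eval_neg_one, legendre_eval_neg_one]
  ring

theorem natDegree_radau_le (p : ℕ) : (radau p).natDegree ≤ p + 1 :=
  (natDegree_sub_le _ _).trans
    (max_le (natDegree_legendre_le _) ((natDegree_legendre_le _).trans p.le_succ))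

theorem coeff_radau_ne_zero (p : ℕ) : (radau p).coeff (p + 1) ≠ 0 := by
  rw [radau, coeff_sub, coeff_eq_zero_of_natDegree_lt (n := p + 1) (p := legendre p)
    ((natDegree_legendre_le p).trans_lt p.lt_succ_self), sub_zero]
  exact coeff_legendre_ne_zero _

theorem cellIntegral_radau_mul_eq_zero (p : ℕ) (V : ℂ[X]) (hV : V.degree < p) :
    cellIntegral (radau p * V) = 0 := by
  rw [radau, sub_mul, map_sub, cellIntegral_legendre_mul_eq_zero p V hV,
    cellIntegral_legendre_mul_eq_zero (p + 1) V (hV.trans (mod_cast p.lt_succ_self)), sub_zero]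

theorem cellIntegral_derivative_radau_mul (p : ℕ) (V : ℂ[X]) (hV : V.natDegree ≤ p) :
    cellIntegral (derivative (radau p) * V) = 2 * (-1) ^ p * V.eval (-1) := by
  have hV' : (derivative V).degree < p := by
    rcases eq_or_ne V 0 with rfl | hne
    · simp
    · exact (degree_derivative_lt hne).trans_le (natDegree_le_iff_degree_le.1 hV)
  rw [cellIntegral_derivative_mul, radau_eval_one, radau_eval_neg_one,
    cellIntegral_radau_mul_eq_zero p _ hV']
  ring

/-! ### The cell space -/

/-- The polynomials of degree at most `p`, i.e. the trial and test functions on one cell; the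
instances below give this space the inner product of `L²(-1,1)`. -/
abbrev Cell (p : ℕ) : Type := degreeLT ℂ (p + 1)

theorem mem_degreeLT_add_one {p : ℕ} {P : ℂ[X]} : P ∈ degreeLT ℂ (p + 1) ↔ P.natDegree ≤ p := by
  rw [degreeLT_succ_eq_degreeLE, mem_degreeLE, natDegree_le_iff_degree_le]

theorem Cell.natDegree_le {p : ℕ} (x : Cell p) : (x : ℂ[X]).natDegree ≤ p :=
  mem_degreeLT_add_one.1 x.2

instance (p : ℕ) : FiniteDimensional ℂ (Cell p) :=
  (degreeLTEquiv ℂ (p + 1)).symm.finiteDimensional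

/-- The polynomial with conjugated coefficients; on the real line it is the complex conjugate. -/
def conjPoly (P : ℂ[X]) : ℂ[X] := P.map (starRingEnd ℂ)

theorem eval_conjPoly_ofReal (P : ℂ[X]) (ξ : ℝ) :
    (conjPoly P).eval (ξ : ℂ) = starRingEnd ℂ (P.eval (ξ : ℂ)) := by
  conv_lhs => rw [conjPoly, ← Complex.conj_ofReal, eval_map_apply]

theorem eval_conjPoly_one (P : ℂ[X]) : (conjPoly P).eval 1 = starRingEnd ℂ (P.eval 1) := by
  simpa using eval_conjPoly_ofReal P 1

theorem eval_conjPoly_neg_one (P : ℂ[X]) :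
    (conjPoly P).eval (-1) = starRingEnd ℂ (P.eval (-1)) := by
  simpa using eval_conjPoly_ofReal P (-1)

theorem conjPoly_conjPoly (P : ℂ[X]) : conjPoly (conjPoly P) = P := by
  ext
  simp [conjPoly]

theorem natDegree_conjPoly_le (P : ℂ[X]) : (conjPoly P).natDegree ≤ P.natDegree :=
  natDegree_map_le

theorem derivative_conjPoly (P : ℂ[X]) : derivative (conjPoly P) = conjPoly (derivative P) :=
  derivative_map _ _

theorem conjPoly_mul (P Q : ℂ[X]) : conjPoly (P * Q) = conjPoly P * conjPoly Q :=
  Polynomial.map_mul _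

theorem cellIntegral_conjPoly (P : ℂ[X]) :
    cellIntegral (conjPoly P) = starRingEnd ℂ (cellIntegral P) := by
  simp only [cellIntegral_apply, eval_conjPoly_ofReal, intervalIntegral.intervalIntegral_conj]

theorem cellIntegral_conjPoly_mul_self (P : ℂ[X]) :
    cellIntegral (conjPoly P * P) = ((∫ ξ in (-1 : ℝ)..1, ‖P.eval (ξ : ℂ)‖ ^ 2 : ℝ) : ℂ) := by
  rw [cellIntegral_mul, ← intervalIntegral.integral_ofReal]
  simp only [eval_conjPoly_ofReal, Complex.conj_mul', Complex.ofReal_pow]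

theorem eq_zero_of_eval_ofReal_eq_zero {a b : ℝ} (hab : a < b) (P : ℂ[X])
    (h : ∀ ξ ∈ Set.Icc a b, P.eval (ξ : ℂ) = 0) : P = 0 := by
  have infinite : (((↑) : ℝ → ℂ) '' Set.Icc a b).Infinite :=
    (Set.Icc_infinite hab).image Complex.ofReal_injective.injOn
  exact eq_zero_of_infinite_isRoot P (infinite.mono (Set.image_subset_iff.2 h))

theorem eq_zero_of_integral_norm_sq_eq_zero (P : ℂ[X])
    (h : ∫ ξ in (-1 : ℝ)..1, ‖P.eval (ξ : ℂ)‖ ^ 2 = 0) : P = 0 := by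
  refine eq_zero_of_eval_ofReal_eq_zero (a := -1) (b := 1) (by norm_num) P ?_
  by_contra! hc
  obtain ⟨ξ, hξ, hne⟩ := hc
  exact (intervalIntegral.integral_pos (f := fun ξ : ℝ => ‖P.eval (ξ : ℂ)‖ ^ 2) (by norm_num)
    ((continuous_eval_ofReal P).norm.pow 2).continuousOn (fun x _ => by positivity)
    ⟨ξ, hξ, by positivity⟩).ne' h

/-- The `L²(-1,1)` inner product on `Cell p`. -/
abbrev cellCore (p : ℕ) : InnerProductSpace.Core ℂ (Cell p) where
  inner x y := cellIntegral (conjPoly x * y)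
  conj_inner_symm x y := by
    rw [← cellIntegral_conjPoly, conjPoly_mul, conjPoly_conjPoly, mul_comm]
  re_inner_nonneg x := by
    rw [cellIntegral_conjPoly_mul_self]
    simp only [RCLike.re_to_complex, Complex.ofReal_re]
    exact intervalIntegral.integral_nonneg (by norm_num) fun _ _ => by positivity
  add_left x y z := by simp [conjPoly, Polynomial.map_add, add_mul]
  smul_left x y r := by simp [conjPoly, Polynomial.map_smul]
  definite x h := by
    rw [cellIntegral_conjPoly_mul_self, Complex.ofReal_eq_zero] at h
    exact Subtype.ext (eq_zero_of_integral_norm_sq_eq_zero _ h)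

instance (p : ℕ) : NormedAddCommGroup (Cell p) := (cellCore p).toNormedAddCommGroup

instance (p : ℕ) : InnerProductSpace ℂ (Cell p) := InnerProductSpace.ofCore (cellCore p).toCore

instance (p : ℕ) : CompleteSpace (Cell p) := FiniteDimensional.complete ℂ _

theorem Cell.inner_def {p : ℕ} (x y : Cell p) :
    inner ℂ x y = cellIntegral (conjPoly x * y) := rfl

theorem Cell.norm_sq {p : ℕ} (x : Cell p) :
    ‖x‖ ^ 2 = ∫ ξ in (-1 : ℝ)..1, ‖(x : ℂ[X]).eval (ξ : ℂ)‖ ^ 2 := by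
  rw [← inner_self_eq_norm_sq (𝕜 := ℂ), Cell.inner_def, cellIntegral_conjPoly_mul_self]
  simp

theorem Cell.norm_le_of_forall_eval {p : ℕ} (x : Cell p) {b : ℝ}
    (h : ∀ ξ ∈ Set.Icc (-1 : ℝ) 1, ‖(x : ℂ[X]).eval (ξ : ℂ)‖ ≤ b) : ‖x‖ ≤ 2 * b := by
  have hb : 0 ≤ b := (norm_nonneg _).trans (h 0 (by simp))
  have norm_sq_le : ‖x‖ ^ 2 ≤ ∫ _ in (-1 : ℝ)..1, b ^ 2 := by
    rw [Cell.norm_sq]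
    refine intervalIntegral.integral_mono_on (by norm_num)
      (((continuous_eval_ofReal _).norm.pow 2).intervalIntegrable _ _) (by simp) fun ξ hξ => ?_
    gcongr
    exact h ξ hξ
  rw [intervalIntegral.integral_const, smul_eq_mul] at norm_sq_le
  nlinarith [norm_nonneg x]

theorem Cell.exists_norm_eval_le (p : ℕ) : ∃ c : ℝ, 0 ≤ c ∧ ∀ x : Cell p,
    ∀ ξ ∈ Set.Icc (-1 : ℝ) 1, ‖(x : ℂ[X]).eval (ξ : ℂ)‖ ≤ c * ‖x‖ := by
  let coeffs : Cell p →L[ℂ] (Fin (p + 1) → ℂ) :=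
    LinearMap.toContinuousLinearMap (degreeLTEquiv ℂ (p + 1)).toLinearMap
  refine ⟨(p + 1) * ‖coeffs‖, by positivity, fun x ξ hξ => ?_⟩
  rw [eval_eq_sum_degreeLTEquiv x.2]
  calc ‖∑ i, coeffs x i * (ξ : ℂ) ^ (i : ℕ)‖
      ≤ ∑ _ : Fin (p + 1), ‖coeffs‖ * ‖x‖ := by
        refine norm_sum_le_of_le _ fun i _ => ?_
        rw [norm_mul, norm_pow, Complex.norm_real, Real.norm_eq_abs]
        have hpow : |ξ| ^ (i : ℕ) ≤ 1 := pow_le_one₀ (abs_nonneg _) (abs_le.2 hξ)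
        have hcoeff : ‖coeffs x i‖ ≤ ‖coeffs‖ * ‖x‖ :=
          (norm_le_pi_norm _ i).trans (coeffs.le_opNorm x)
        exact (mul_le_mul hcoeff hpow (by positivity) (by positivity)).trans_eq (mul_one _)
    _ = (p + 1) * ‖coeffs‖ * ‖x‖ := by simp [mul_assoc]

theorem cellIntegral_mul_eq_zero_of_legendre {p : ℕ} {P : ℂ[X]}
    (h : ∀ k ≤ p, cellIntegral (P * legendre k) = 0) {V : ℂ[X]} (hV : V.natDegree ≤ p) :
    cellIntegral (P * V) = 0 := by
  let S : Polynomial.Sequence ℂ := ⟨legendre, degree_legendre⟩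
  let φ : ℂ[X] →ₗ[ℂ] ℂ := cellIntegral ∘ₗ LinearMap.mulLeft ℂ P
  have hφ : degreeLT ℂ (p + 1) ≤ LinearMap.ker φ := by
    rw [← S.span_degreeLT fun i _ => (leadingCoeff_ne_zero.2 (S.ne_zero i)).isUnit,
      Submodule.span_le]
    rintro _ ⟨k, hk, rfl⟩
    exact h k (Nat.le_of_lt_succ hk)
  exact hφ (mem_degreeLT_add_one.2 hV)

theorem Cell.eq_zero_of_legendre_moments {p : ℕ} {x : Cell p}
    (h : ∀ k ≤ p, cellIntegral ((x : ℂ[X]) * legendre k) = 0) : x = 0 := by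
  rw [← inner_self_eq_zero (𝕜 := ℂ), Cell.inner_def, mul_comm]
  exact cellIntegral_mul_eq_zero_of_legendre h ((natDegree_conjPoly_le _).trans x.natDegree_le)

theorem Cell.exists_norm_le_of_legendre_moments (p : ℕ) : ∃ c : ℝ, 0 ≤ c ∧ ∀ (x : Cell p) (b : ℝ),
    (∀ k ≤ p, ‖cellIntegral ((x : ℂ[X]) * legendre k)‖ ≤ b) → ‖x‖ ≤ c * b := by
  let moments : Cell p →ₗ[ℂ] (Fin (p + 1) → ℂ) := LinearMap.pi fun k =>
    cellIntegral ∘ₗ LinearMap.mulRight ℂ (legendre k) ∘ₗ (degreeLT ℂ (p + 1)).subtype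
  have injective : LinearMap.ker moments = ⊥ := LinearMap.ker_eq_bot'.2 fun x hx =>
    Cell.eq_zero_of_legendre_moments fun k hk => congrFun hx ⟨k, Nat.lt_succ_of_le hk⟩
  obtain ⟨K, -, hK⟩ := moments.exists_antilipschitzWith injective
  refine ⟨K, K.2, fun x b h => ?_⟩
  have hb : 0 ≤ b := (norm_nonneg _).trans (h 0 p.zero_le)
  have norm_moments : ‖moments x‖ ≤ b :=
    (pi_norm_le_iff_of_nonneg hb).2 fun k => h k (Nat.le_of_lt_succ k.2)
  have antilipschitz := hK.le_mul_dist x 0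
  rw [map_zero, dist_zero_right, dist_zero_right] at antilipschitz
  exact antilipschitz.trans (mul_le_mul_of_nonneg_left norm_moments K.2)

/-! ### The upwind operator on a cell -/

/-- Evaluation at `ξ` as a continuous functional on the cell space. -/
def evalAt (p : ℕ) (ξ : ℂ) : Cell p →L[ℂ] ℂ :=
  LinearMap.toContinuousLinearMap (leval ξ ∘ₗ (degreeLT ℂ (p + 1)).subtype)

theorem evalAt_apply (p : ℕ) (ξ : ℂ) (x : Cell p) : evalAt p ξ x = (x : ℂ[X]).eval ξ := rfl

/-- Differentiation as a continuous operator on the cell space. -/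
def derivOp (p : ℕ) : Cell p →L[ℂ] Cell p :=
  LinearMap.toContinuousLinearMap <| derivative.restrict fun _ hP => mem_degreeLT_add_one.2 <|
    (natDegree_derivative_le _).trans <| (Nat.sub_le _ _).trans (mem_degreeLT_add_one.1 hP)

theorem coe_derivOp (p : ℕ) (x : Cell p) : (derivOp p x : ℂ[X]) = derivative (x : ℂ[X]) := rfl

theorem coe_derivOp_pow (p k : ℕ) (x : Cell p) :
    ((derivOp p ^ k) x : ℂ[X]) = derivative^[k] (x : ℂ[X]) := by
  induction k with
  | zero => simp
  | succ k ih =>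
    rw [pow_succ', mul_apply_eq_comp, coe_derivOp, ih, Function.iterate_succ_apply']

/-- Twice the Riesz representative of evaluation at the inflow end `-1`; it is `(-1)^p R'`, with
`R` the Radau polynomial. -/
def inflowDelta (p : ℕ) : Cell p :=
  ⟨(-1 : ℂ) ^ p • derivative (radau p), mem_degreeLT_add_one.2 <| (natDegree_smul_le _ _).trans <|
    (natDegree_derivative_le _).trans (Nat.sub_le_of_le_add (natDegree_radau_le p))⟩

theorem coe_inflowDelta (p : ℕ) :
    (inflowDelta p : ℂ[X]) = (-1 : ℂ) ^ p • derivative (radau p) := rfl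

theorem cellIntegral_inflowDelta_mul (p : ℕ) (V : ℂ[X]) (hV : V.natDegree ≤ p) :
    cellIntegral ((inflowDelta p : ℂ[X]) * V) = 2 * V.eval (-1) := by
  have sign : (-1 : ℂ) ^ p * (-1) ^ p = 1 := by rw [← mul_pow]; norm_num
  rw [coe_inflowDelta, smul_mul_assoc, map_smul, cellIntegral_derivative_radau_mul p V hV,
    smul_eq_mul]
  linear_combination 2 * V.eval (-1) * sign

/-- The part of the upwind operator that acts on the cell itself. -/
def localOp (p : ℕ) : Cell p →L[ℂ] Cell p :=
  -(2 : ℂ) • derivOp p - (evalAt p (-1)).smulRight (inflowDelta p)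

/-- The part of the upwind operator that takes the outflow value of the left neighbour. -/
def inflowOp (p : ℕ) : Cell p →L[ℂ] Cell p := (evalAt p 1).smulRight (inflowDelta p)

/-- The upwind operator, in units of `a / h`, on grid functions whose value on the left neighbour
of a cell is `w` times that on the cell. -/
def upwind (p : ℕ) (w : ℂ) : Cell p →L[ℂ] Cell p := localOp p + w • inflowOp p

theorem upwind_apply (p : ℕ) (w : ℂ) (x : Cell p) : upwind p w x =
    (w * (x : ℂ[X]).eval 1 - (x : ℂ[X]).eval (-1)) • inflowDelta p - (2 : ℂ) • derivOp p x := by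
  simp only [upwind, localOp, inflowOp, add_apply, sub_apply, smul_apply,
    ContinuousLinearMap.smulRight_apply, evalAt_apply]
  module

theorem coe_upwind (p : ℕ) (w : ℂ) (x : Cell p) : (upwind p w x : ℂ[X]) =
    (w * (x : ℂ[X]).eval 1 - (x : ℂ[X]).eval (-1)) • (inflowDelta p : ℂ[X]) -
      (2 : ℂ) • derivative (x : ℂ[X]) := by
  rw [upwind_apply]
  rfl

theorem cellIntegral_upwind_mul (p : ℕ) (w : ℂ) (x : Cell p) (V : ℂ[X]) (hV : V.natDegree ≤ p) :
    cellIntegral ((upwind p w x : ℂ[X]) * V) =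
      2 * (cellIntegral ((x : ℂ[X]) * derivative V) - (x : ℂ[X]).eval 1 * V.eval 1
        + w * ((x : ℂ[X]).eval 1 * V.eval (-1))) := by
  rw [coe_upwind, sub_mul, map_sub, smul_mul_assoc, smul_mul_assoc, map_smul, map_smul,
    cellIntegral_inflowDelta_mul p V hV, cellIntegral_derivative_mul, smul_eq_mul, smul_eq_mul]
  ring

theorem cellIntegral_localOp_mul (p : ℕ) (x : Cell p) (V : ℂ[X]) (hV : V.natDegree ≤ p) :
    cellIntegral ((localOp p x : ℂ[X]) * V) =
      2 * (cellIntegral ((x : ℂ[X]) * derivative V) - (x : ℂ[X]).eval 1 * V.eval 1) := by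
  simpa [upwind] using cellIntegral_upwind_mul p 0 x V hV

theorem cellIntegral_inflowOp_mul (p : ℕ) (x : Cell p) (V : ℂ[X]) (hV : V.natDegree ≤ p) :
    cellIntegral ((inflowOp p x : ℂ[X]) * V) = 2 * ((x : ℂ[X]).eval 1 * V.eval (-1)) := by
  rw [inflowOp, ContinuousLinearMap.smulRight_apply, Submodule.coe_smul, smul_mul_assoc, map_smul,
    cellIntegral_inflowDelta_mul p V hV, evalAt_apply, smul_eq_mul]
  ring

theorem re_inner_upwind (p : ℕ) {w : ℂ} (hw : ‖w‖ = 1) (x : Cell p) :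
    (inner ℂ x (upwind p w x)).re = -‖(x : ℂ[X]).eval (-1) - w * (x : ℂ[X]).eval 1‖ ^ 2 := by
  set P : ℂ[X] := x.1
  set I := cellIntegral (P * derivative (conjPoly P)) with hI
  have by_parts : starRingEnd ℂ I = P.eval 1 * starRingEnd ℂ (P.eval 1) -
      P.eval (-1) * starRingEnd ℂ (P.eval (-1)) - I := by
    rw [hI, ← cellIntegral_conjPoly, conjPoly_mul, derivative_conjPoly, conjPoly_conjPoly,
      ← derivative_conjPoly, mul_comm, cellIntegral_derivative_mul, eval_conjPoly_one,
      eval_conjPoly_neg_one]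
  have norm_sq_w : w.re * w.re + w.im * w.im = 1 := by
    rw [← Complex.normSq_apply, Complex.normSq_eq_norm_sq, hw, one_pow]
  rw [Cell.inner_def, mul_comm, cellIntegral_upwind_mul p w x _
    ((natDegree_conjPoly_le _).trans x.natDegree_le), eval_conjPoly_one, eval_conjPoly_neg_one,
    ← Complex.normSq_eq_norm_sq, Complex.normSq_apply]
  have by_parts_re := congrArg Complex.re by_parts
  simp only [Complex.sub_re, Complex.mul_re, Complex.conj_re, Complex.conj_im, Complex.add_re,
    Complex.sub_im, Complex.mul_im, Complex.re_ofNat, Complex.im_ofNat] at by_parts_re ⊢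
  linear_combination by_parts_re + ((P.eval 1).re ^ 2 + (P.eval 1).im ^ 2) * norm_sq_w

theorem re_inner_upwind_nonpos (p : ℕ) {w : ℂ} (hw : ‖w‖ = 1) (x : Cell p) :
    (inner ℂ x (upwind p w x)).re ≤ 0 := by
  rw [re_inner_upwind p hw, neg_nonpos]
  positivity

/-- The bilinear form `∫ x(-ξ) y(ξ) dξ`, for which the upwind operator is symmetric. -/
def reflectForm (p : ℕ) : Cell p →L[ℂ] Cell p →L[ℂ] ℂ :=
  LinearMap.toContinuousBilinearMap <|
    LinearMap.mk₂ ℂ (fun x y : Cell p => cellIntegral ((x : ℂ[X]).comp (-X) * y))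
      (fun x y z => by simp [add_comp, add_mul]) (fun c x y => by simp [smul_comp])
      (fun x y z => by simp [mul_add]) (fun c x y => by simp)

theorem reflectForm_apply (p : ℕ) (x y : Cell p) :
    reflectForm p x y = cellIntegral ((x : ℂ[X]).comp (-X) * y) := rfl

theorem cellIntegral_comp_neg_mul (P Q : ℂ[X]) :
    cellIntegral (P.comp (-X) * Q) = cellIntegral (P * Q.comp (-X)) := by
  rw [← cellIntegral_comp_neg, mul_comp, comp_assoc]
  simp

theorem natDegree_comp_neg_X (P : ℂ[X]) : (P.comp (-X)).natDegree = P.natDegree := by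
  simp [natDegree_comp]

theorem reflectForm_upwind (p : ℕ) (w : ℂ) (x y : Cell p) :
    reflectForm p (upwind p w x) y = reflectForm p x (upwind p w y) := by
  have derivative_reflect (P : ℂ[X]) : derivative (P.comp (-X)) = -(derivative P).comp (-X) := by
    simp [derivative_comp]
  rw [reflectForm_apply, reflectForm_apply, cellIntegral_comp_neg_mul,
    cellIntegral_upwind_mul p w x _ ((natDegree_comp_neg_X _).trans_le y.natDegree_le),
    mul_comm ((x : ℂ[X]).comp (-X)),
    cellIntegral_upwind_mul p w y _ ((natDegree_comp_neg_X _).trans_le x.natDegree_le),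
    derivative_reflect (x : ℂ[X]), mul_neg, map_neg, mul_comm (y : ℂ[X]),
    cellIntegral_comp_neg_mul, cellIntegral_derivative_mul]
  simp only [eval_comp, eval_neg, eval_X, neg_neg]
  ring

/-! ### The physical mode -/

/-- The polynomial `f(z, ·)` as an element of the cell space, see `eval_mode`. -/
def mode (p : ℕ) (z : ℂ) : Cell p :=
  -∑ k ∈ Finset.range (p + 1), (2 ^ k * z ^ (p - k)) • (derivOp p ^ k) (inflowDelta p)

theorem eval_mode (p : ℕ) (z ξ : ℂ) : (mode p z : ℂ[X]).eval ξ = fPoly p z ξ := by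
  rw [mode, fPoly, ← Finset.Ico_add_one_right_eq_Icc, Finset.sum_Ico_eq_sum_range, ← evalAt_apply,
    map_neg, map_sum, Finset.mul_sum, ← Finset.sum_neg_distrib]
  refine Finset.sum_congr rfl fun k _ => ?_
  rw [map_smul, evalAt_apply, coe_derivOp_pow, coe_inflowDelta, iterate_derivative_smul, eval_smul,
    ← Function.iterate_succ_apply, smul_eq_mul, smul_eq_mul, add_comm 1 k, Nat.add_sub_add_right]
  ring

theorem derivOp_pow_succ (p : ℕ) : derivOp p ^ (p + 1) = 0 := by
  ext1 x
  refine Subtype.ext ?_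
  rw [coe_derivOp_pow]
  exact iterate_derivative_eq_zero (Nat.lt_succ_of_le x.natDegree_le)

theorem smul_mode_sub (p : ℕ) (z : ℂ) :
    z • mode p z - (2 : ℂ) • derivOp p (mode p z) = -(z ^ (p + 1) • inflowDelta p) := by
  let b (k : ℕ) : Cell p := (2 ^ k * z ^ (p + 1 - k)) • (derivOp p ^ k) (inflowDelta p)
  have telescope : ∀ k ∈ Finset.range (p + 1),
      z • (2 ^ k * z ^ (p - k)) • (derivOp p ^ k) (inflowDelta p) -
        (2 : ℂ) • derivOp p ((2 ^ k * z ^ (p - k)) • (derivOp p ^ k) (inflowDelta p)) =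
      b k - b (k + 1) := by
    intro k hk
    rw [map_smul, ← mul_apply_eq_comp, ← pow_succ']
    simp only [b, Nat.add_sub_add_right, Nat.sub_add_comm (Finset.mem_range_succ_iff.1 hk)]
    module
  have b_last : b (p + 1) = 0 := by simp only [b, derivOp_pow_succ, zero_apply, smul_zero]
  rw [mode, map_neg, map_sum, smul_neg, smul_neg, ← neg_sub', Finset.smul_sum, Finset.smul_sum,
    ← Finset.sum_sub_distrib, Finset.sum_congr rfl telescope, Finset.sum_range_sub', b_last]
  simp [b]

theorem upwind_mode (p : ℕ) (w z : ℂ) : upwind p w (mode p z) =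
    -(z • mode p z) + (w * fPoly p z 1 - gPoly p z) • inflowDelta p := by
  rw [upwind_apply, eval_mode, eval_mode, gPoly]
  linear_combination (norm := module) smul_mode_sub p z

theorem exists_mode_zero_eq_C (p : ℕ) : ∃ c : ℂ, c ≠ 0 ∧ (mode p 0 : ℂ[X]) = C c := by
  set D := (derivOp p ^ p) (inflowDelta p) with hD
  have coe_D : (D : ℂ[X]) = C ((-1) ^ p * (derivative^[p + 1] (radau p)).coeff 0) := by
    have hdeg : (derivative^[p + 1] (radau p)).natDegree ≤ 0 :=
      (natDegree_iterate_derivative _ _).trans (Nat.sub_eq_zero_of_le (natDegree_radau_le p)).le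
    rw [hD, coe_derivOp_pow, coe_inflowDelta, iterate_derivative_smul,
      ← Function.iterate_succ_apply, eq_C_of_natDegree_le_zero hdeg, smul_C, coeff_C_zero,
      smul_eq_mul]
  have mode_zero : mode p 0 = -((2 : ℂ) ^ p • D) := by
    rw [mode, Finset.sum_range_succ, Finset.sum_eq_zero fun k hk => ?_]
    · simp [D]
    · rw [zero_pow (Nat.sub_ne_zero_of_lt (Finset.mem_range.1 hk)), mul_zero, zero_smul]
  refine ⟨-(2 ^ p * ((-1) ^ p * (derivative^[p + 1] (radau p)).coeff 0)), ?_, ?_⟩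
  · rw [coeff_iterate_derivative, zero_add, nsmul_eq_mul]
    simp [coeff_radau_ne_zero, Nat.descFactorial_eq_zero_iff_lt]
  · rw [mode_zero, Submodule.coe_neg, Submodule.coe_smul, coe_D, smul_C, ← C_neg, smul_eq_mul]

theorem reflectForm_ne_zero_of_eq_C {p : ℕ} {x y : Cell p} {c d : ℂ} (hc : c ≠ 0) (hd : d ≠ 0)
    (hx : (x : ℂ[X]) = C c) (hy : (y : ℂ[X]) = C d) : reflectForm p x y ≠ 0 := by
  rw [reflectForm_apply, hx, hy, C_comp, ← C_mul, cellIntegral_apply]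
  simp [hc, hd]

theorem differentiable_mode (p : ℕ) : Differentiable ℂ (mode p) := by
  unfold mode
  fun_prop

/-! ### Non-physical roots and the spectrum of the periodic cell operator -/

theorem eq_zero_of_smul_eq_derivOp {p : ℕ} {z : ℂ} (hz : z ≠ 0) {x : Cell p}
    (h : z • x = (2 : ℂ) • derivOp p x) : x = 0 := by
  by_contra hx
  have hx' : (x : ℂ[X]) ≠ 0 := fun h0 => hx (Subtype.ext h0)
  have same_degree := congrArg (fun y : Cell p => (y : ℂ[X]).degree) h
  simp only [Submodule.coe_smul, coe_derivOp,
    degree_smul_of_smul_regular _ (IsSMulRegular.of_ne_zero hz),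
    degree_smul_of_smul_regular _ (IsSMulRegular.of_ne_zero (two_ne_zero (α := ℂ)))]
    at same_degree
  exact (degree_derivative_lt hx').ne same_degree.symm

theorem isNonphysicalRoot_of_upwind_eq {p : ℕ} {x : Cell p} (hx : x ≠ 0) {z : ℂ} (hz : z ≠ 0)
    (h : upwind p 1 x = -(z • x)) : IsNonphysicalRoot p z := by
  set J := (x : ℂ[X]).eval (-1) - (x : ℂ[X]).eval 1 with hJ
  have eigen : z • x - (2 : ℂ) • derivOp p x = J • inflowDelta p := by
    rw [upwind_apply, one_mul] at h
    rw [hJ]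
    linear_combination (norm := module) h
  have J_ne_zero : J ≠ 0 := by
    intro h0
    rw [h0, zero_smul, sub_eq_zero] at eigen
    exact hx (eq_zero_of_smul_eq_derivOp hz eigen)
  have proportional : z ^ (p + 1) • x + J • mode p z = 0 := by
    refine eq_zero_of_smul_eq_derivOp hz ?_
    rw [map_add, map_smul, map_smul]
    linear_combination (norm := module) z ^ (p + 1) • eigen + J • smul_mode_sub p z
  have eval_proportional (ξ : ℂ) : z ^ (p + 1) * (x : ℂ[X]).eval ξ + J * fPoly p z ξ = 0 := by
    simpa [evalAt_apply, eval_mode] using congrArg (evalAt p ξ) proportional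
  refine ⟨hz, (mul_eq_zero.1 ?_).resolve_left J_ne_zero⟩
  rw [gPoly]
  linear_combination eval_proportional (-1) - eval_proportional 1 + z ^ (p + 1) * hJ

theorem IsNonphysicalRoot.re_pos {p : ℕ} {z : ℂ} (h : IsNonphysicalRoot p z) : 0 < z.re := by
  have eigen : upwind p 1 (mode p z) = -(z • mode p z) := by
    rw [upwind_mode, one_mul, ← neg_sub, h.2, neg_zero, zero_smul, add_zero]
  have jump : fPoly p z (-1) - 1 * fPoly p z 1 = -z ^ (p + 1) := by
    have root := h.2
    rw [gPoly] at root
    linear_combination root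
  have energy : z.re * ‖mode p z‖ ^ 2 = ‖z ^ (p + 1)‖ ^ 2 := by
    have := re_inner_upwind p (w := 1) (by simp) (mode p z)
    rw [eigen, inner_neg_right, inner_smul_right, inner_self_eq_norm_sq_to_K, eval_mode, eval_mode,
      jump, norm_neg, Complex.neg_re, neg_inj] at this
    rwa [← Complex.re_mul_ofReal, Complex.ofReal_pow]
  have : 0 < ‖z ^ (p + 1)‖ ^ 2 := pow_pos (norm_pos_iff.2 (pow_ne_zero _ h.1)) 2
  exact pos_of_mul_pos_left (energy ▸ this) (sq_nonneg _)

theorem exists_eq_C_of_upwind_eq_zero {p : ℕ} {x : Cell p} (h : upwind p 1 x = 0) :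
    ∃ c : ℂ, (x : ℂ[X]) = C c := by
  have jump : 1 * (x : ℂ[X]).eval 1 - (x : ℂ[X]).eval (-1) = 0 := by
    have := re_inner_upwind p (w := 1) (by simp) x
    rw [h, inner_zero_right, Complex.zero_re, zero_eq_neg, sq_eq_zero_iff, norm_eq_zero] at this
    rw [← neg_sub, this, neg_zero]
  have derivative_eq : derivative (x : ℂ[X]) = 0 := by
    have := congrArg Subtype.val h
    rw [coe_upwind, jump] at this
    simpa using this
  exact ⟨_, eq_C_of_natDegree_eq_zero (derivative_eq_zero.1 derivative_eq)⟩

/-! ### The Padé property -/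

theorem integral_derivative_sub_C_mul_mul_exp (H : ℂ[X]) (c : ℂ) :
    ∫ ξ in (-1 : ℝ)..1, (derivative H - C c * H).eval (ξ : ℂ) * Complex.exp (-c * ξ) =
      H.eval 1 * Complex.exp (-c) - H.eval (-1) * Complex.exp c := by
  have hasDerivAt (x : ℝ) : HasDerivAt (fun ξ : ℝ => H.eval (ξ : ℂ) * Complex.exp (-c * ξ))
      ((derivative H - C c * H).eval (x : ℂ) * Complex.exp (-c * x)) x := by
    have exp_deriv := (((hasDerivAt_id (x : ℂ)).const_mul (-c)).cexp).comp_ofReal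
    refine ((hasDerivAt_eval_ofReal H x).mul exp_deriv).congr_deriv ?_
    simp only [id, eval_sub, eval_mul, eval_C]
    ring
  have := continuous_eval_ofReal (derivative H - C c * H)
  rw [intervalIntegral.integral_eq_sub_of_hasDerivAt (fun x _ => hasDerivAt x)
    (Continuous.intervalIntegrable (by fun_prop) _ _)]
  simp

theorem gPoly_sub_exp_mul_fPoly (p : ℕ) (z : ℂ) :
    gPoly p z - Complex.exp (-z) * fPoly p z 1 =
      Complex.exp (-(z / 2)) * ((-1) ^ (p + 1) / 4 * z ^ (p + 2)) *
        ∫ ξ in (-1 : ℝ)..1, (radau p).eval (ξ : ℂ) * Complex.exp (-(z / 2) * ξ) := by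
  set a : ℂ := (-1) ^ (p + 1) / 2 * z ^ (p + 1) with ha
  have sign : ((-1 : ℂ) ^ (p + 1)) ^ 2 = 1 := by rw [← pow_mul, mul_comm, pow_mul]; simp
  -- `H` equals `f(z,1)` at `1` and `g(z)` at `-1`, and `H' - (z/2) H` is a multiple of `R`.
  set H : ℂ[X] := mode p z + a • radau p with hH
  have H_one : H.eval 1 = fPoly p z 1 := by simp [hH, eval_mode, radau_eval_one]
  have H_neg_one : H.eval (-1) = gPoly p z := by
    simp only [hH, eval_add, eval_mode, eval_smul, radau_eval_neg_one, smul_eq_mul, gPoly, ha]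
    linear_combination z ^ (p + 1) * sign
  have H_deriv : derivative H - C (z / 2) * H = C (-(z / 2 * a)) * radau p := by
    have mode_deriv : z • (mode p z : ℂ[X]) - (2 : ℂ) • derivative (mode p z : ℂ[X]) =
        -(z ^ (p + 1) • (-1 : ℂ) ^ p • derivative (radau p)) :=
      congrArg Subtype.val (smul_mode_sub p z)
    rw [hH, ← smul_eq_C_mul, ← smul_eq_C_mul, derivative_add, derivative_smul, ha]
    linear_combination (norm := module) (-1 / 2 : ℂ) • mode_deriv
  have key := integral_derivative_sub_C_mul_mul_exp H (z / 2)
  rw [H_deriv, H_one, H_neg_one] at key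
  simp only [eval_mul, eval_C, mul_assoc, intervalIntegral.integral_const_mul] at key
  have exp_neg : Complex.exp (-z) = Complex.exp (-(z / 2)) * Complex.exp (-(z / 2)) := by
    rw [← Complex.exp_add]
    ring_nf
  have exp_cancel : Complex.exp (-(z / 2)) * Complex.exp (z / 2) = 1 := by
    rw [← Complex.exp_add, neg_add_cancel, Complex.exp_zero]
  rw [exp_neg]
  rw [ha] at key
  linear_combination Complex.exp (-(z / 2)) * key - gPoly p z * exp_cancel

theorem exists_norm_integral_mul_exp_le {P : ℂ[X]} {n : ℕ}
    (orthogonal : ∀ V : ℂ[X], V.degree < n → cellIntegral (P * V) = 0) :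
    ∃ c : ℝ, 0 ≤ c ∧ ∀ z : ℂ, ‖z‖ ≤ 1 →
      ‖∫ ξ in (-1 : ℝ)..1, P.eval (ξ : ℂ) * Complex.exp (z * ξ)‖ ≤ c * ‖z‖ ^ n := by
  obtain ⟨b, hb⟩ := (isCompact_Icc (a := (-1 : ℝ)) (b := 1)).exists_bound_of_continuousOn
    (continuous_eval_ofReal P).continuousOn
  have hb0 : 0 ≤ b := (norm_nonneg _).trans (hb 0 (by simp))
  refine ⟨b * Real.exp 1 * 2, by positivity, fun z hz => ?_⟩
  let T : ℂ[X] := ∑ m ∈ Finset.range n, C (z ^ m / m.factorial) * X ^ m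
  have degree_T : T.degree < n := by
    refine (degree_sum_le _ _).trans_lt ((Finset.sup_lt_iff (WithBot.bot_lt_coe n)).2 ?_)
    intro m hm
    exact (degree_C_mul_X_pow_le _ _).trans_lt (WithBot.coe_lt_coe.2 (Finset.mem_range.1 hm))
  have eval_T (ξ : ℂ) : T.eval ξ = ∑ m ∈ Finset.range n, (z * ξ) ^ m / m.factorial := by
    simp only [T, eval_finsetSum, eval_mul, eval_C, eval_pow, eval_X, mul_pow, mul_div_right_comm]
  have subtract_T : ∫ ξ in (-1 : ℝ)..1, P.eval (ξ : ℂ) * Complex.exp (z * ξ) =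
      ∫ ξ in (-1 : ℝ)..1, P.eval (ξ : ℂ) * (Complex.exp (z * ξ) - T.eval (ξ : ℂ)) := by
    have := continuous_eval_ofReal P
    have := continuous_eval_ofReal T
    simp only [mul_sub]
    rw [intervalIntegral.integral_sub (Continuous.intervalIntegrable (by fun_prop) _ _)
      (Continuous.intervalIntegrable (by fun_prop) _ _), ← cellIntegral_mul,
      orthogonal T degree_T, sub_zero]
  have pointwise : ∀ ξ ∈ Set.uIoc (-1 : ℝ) 1,
      ‖P.eval (ξ : ℂ) * (Complex.exp (z * ξ) - T.eval (ξ : ℂ))‖ ≤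
        b * (‖z‖ ^ n * Real.exp 1) := by
    intro ξ hξ
    rw [Set.uIoc_of_le (by norm_num)] at hξ
    have hξ' : ξ ∈ Set.Icc (-1 : ℝ) 1 := ⟨hξ.1.le, hξ.2⟩
    have norm_mul_le : ‖z * ξ‖ ≤ ‖z‖ := by
      rw [norm_mul, Complex.norm_real]
      exact mul_le_of_le_one_right (norm_nonneg _) (abs_le.2 hξ')
    rw [norm_mul, eval_T]
    refine mul_le_mul (hb ξ hξ') ?_ (norm_nonneg _) hb0
    refine (Complex.norm_exp_sub_sum_le_norm_mul_exp _ _).trans ?_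
    gcongr
    exact norm_mul_le.trans hz
  rw [subtract_T]
  refine (intervalIntegral.norm_integral_le_of_norm_le_const pointwise).trans_eq ?_
  norm_num
  ring

theorem exists_norm_gPoly_sub_exp_mul_fPoly_le (p : ℕ) : ∃ c : ℝ, 0 ≤ c ∧ ∀ z : ℂ, ‖z‖ ≤ 1 →
    ‖gPoly p z - Complex.exp (-z) * fPoly p z 1‖ ≤ c * ‖z‖ ^ (2 * p + 2) := by
  obtain ⟨c, hc, h⟩ := exists_norm_integral_mul_exp_le (cellIntegral_radau_mul_eq_zero p)
  refine ⟨Real.exp 1 * c, by positivity, fun z hz => ?_⟩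
  have norm_half : ‖-(z / 2)‖ ≤ ‖z‖ := by
    rw [norm_neg, norm_div, Complex.norm_ofNat]
    linarith [norm_nonneg z]
  have norm_exp : ‖Complex.exp (-(z / 2))‖ ≤ Real.exp 1 :=
    (Complex.norm_exp_le_exp_norm _).trans (Real.exp_le_exp.2 (norm_half.trans hz))
  have norm_power : ‖(-1 : ℂ) ^ (p + 1) / 4 * z ^ (p + 2)‖ ≤ ‖z‖ ^ (p + 2) := by
    rw [norm_mul, norm_div, norm_pow, norm_pow, norm_neg, norm_one, one_pow]
    exact mul_le_of_le_one_left (by positivity) (by norm_num)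
  have norm_integral :
      ‖∫ ξ in (-1 : ℝ)..1, (radau p).eval (ξ : ℂ) * Complex.exp (-(z / 2) * ξ)‖ ≤ c * ‖z‖ ^ p :=
    (h _ (norm_half.trans hz)).trans (by gcongr)
  rw [gPoly_sub_exp_mul_fPoly, norm_mul, norm_mul]
  calc _ ≤ Real.exp 1 * ‖z‖ ^ (p + 2) * (c * ‖z‖ ^ p) := by gcongr
    _ = _ := by ring

/-! ### Operator semigroups -/

section Flow

open Filter Topology

variable {E : Type*} [NormedAddCommGroup E] [NormedSpace ℂ E]

/-- The semigroup `e^{τ T}` generated by a bounded operator. -/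
def flow (T : E →L[ℂ] E) (τ : ℝ) : E →L[ℂ] E := NormedSpace.exp ((τ : ℂ) • T)

theorem flow_zero (T : E →L[ℂ] E) : flow T 0 = 1 := by
  simp [flow, NormedSpace.exp_zero]

theorem flow_apply_comm (T : E →L[ℂ] E) (τ : ℝ) (x : E) : flow T τ (T x) = T (flow T τ x) :=
  congrArg (fun S : E →L[ℂ] E => S x) ((Commute.refl T).smul_left (τ : ℂ)).exp_left.eq

theorem norm_clm_pow_le (T : E →L[ℂ] E) (n : ℕ) : ‖T ^ n‖ ≤ ‖T‖ ^ n := by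
  rcases n.eq_zero_or_pos with rfl | hn
  · simpa using! ContinuousLinearMap.norm_id_le (𝕜 := ℂ) (E := E)
  · exact norm_pow_le' T hn

variable [CompleteSpace E]

theorem flow_add (T : E →L[ℂ] E) (σ τ : ℝ) : flow T (σ + τ) = flow T σ * flow T τ := by
  let +nondep : NormedAlgebra ℚ (E →L[ℂ] E) := .restrictScalars ℚ ℂ _
  rw [flow, flow, flow, ← NormedSpace.exp_add_of_commute, ← add_smul, Complex.ofReal_add]
  exact ((Commute.refl T).smul_left _).smul_right _

theorem flow_add_apply (T : E →L[ℂ] E) (σ τ : ℝ) (x : E) :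
    flow T (σ + τ) x = flow T σ (flow T τ x) := by
  rw [flow_add, mul_apply_eq_comp]

theorem flow_nat_mul (T : E →L[ℂ] E) (n : ℕ) (τ : ℝ) : flow T (n * τ) = flow T τ ^ n := by
  induction n with
  | zero => simp [flow_zero]
  | succ n ih => rw [Nat.cast_succ, add_mul, one_mul, flow_add, ih, pow_succ]

theorem continuous_flow (τ : ℝ) : Continuous fun T : E →L[ℂ] E => flow T τ := by
  let +nondep : NormedAlgebra ℚ (E →L[ℂ] E) := .restrictScalars ℚ ℂ _
  exact NormedSpace.exp_continuous.comp (continuous_const_smul _)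

theorem hasDerivAt_flow (T : E →L[ℂ] E) (τ : ℝ) : HasDerivAt (flow T) (T * flow T τ) τ := by
  refine ((hasDerivAt_exp_smul_const' T (τ : ℂ)).scomp τ
    Complex.ofRealCLM.hasDerivAt).congr_deriv ?_
  rw [Complex.ofRealCLM_apply, Complex.ofReal_one, one_smul]
  rfl

theorem hasDerivWithinAt_flow_apply (T : E →L[ℂ] E) {φ : ℝ → ℝ} {y : ℝ → E} {φ' : ℝ} {y' : E}
    {s : Set ℝ} {t : ℝ} (hφ : HasDerivWithinAt φ φ' s t) (hy : HasDerivWithinAt y y' s t) :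
    HasDerivWithinAt (fun r => flow T (φ r) (y r)) (flow T (φ t) (y' + φ' • T (y t))) s t := by
  have apply_deriv := (isBoundedBilinearMap_apply (𝕜 := ℂ) (E := E) (F := E)).hasFDerivAt
    (flow T (φ t), y t)
  refine ((apply_deriv.restrictScalars ℝ).comp_hasDerivWithinAt t
    (((hasDerivAt_flow T (φ t)).scomp_hasDerivWithinAt t hφ).prodMk hy)).congr_deriv ?_
  simp [flow_apply_comm]

theorem hasDerivAt_flow_apply (T : E →L[ℂ] E) {φ : ℝ → ℝ} {y : ℝ → E} {φ' : ℝ} {y' : E} {t : ℝ}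
    (hφ : HasDerivAt φ φ' t) (hy : HasDerivAt y y' t) :
    HasDerivAt (fun r => flow T (φ r) (y r)) (flow T (φ t) (y' + φ' • T (y t))) t := by
  rw [← hasDerivWithinAt_univ] at hφ hy ⊢
  exact hasDerivWithinAt_flow_apply T hφ hy

theorem hasDerivAt_flow_apply_const (T : E →L[ℂ] E) (x : E) (τ : ℝ) :
    HasDerivAt (fun σ => flow T σ x) (T (flow T τ x)) τ := by
  simpa [flow_apply_comm] using
    hasDerivAt_flow_apply T (hasDerivAt_id τ) (hasDerivAt_const τ x)

theorem eq_flow_of_hasDerivWithinAt {T : E →L[ℂ] E} {y : ℝ → E} {c : ℝ}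
    (h : ∀ t, 0 ≤ t → HasDerivWithinAt y (c • T (y t)) (Set.Ici 0) t) {t : ℝ} (ht : 0 ≤ t) :
    y t = flow T (c * t) (y 0) := by
  have deriv_zero : ∀ s, 0 ≤ s →
      HasDerivWithinAt (fun s => flow T (-(c * s)) (y s)) 0 (Set.Ici 0) s := by
    intro s hs
    have := hasDerivWithinAt_flow_apply T
      ((hasDerivWithinAt_id s (Set.Ici 0)).const_mul c).neg (h s hs)
    simpa using this
  have constant := constant_of_has_deriv_right_zero
    (fun s hs => (deriv_zero s hs.1).continuousWithinAt.mono Set.Icc_subset_Ici_self)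
    (fun s hs => (deriv_zero s hs.1).mono (Set.Ici_subset_Ici.2 hs.1)) t (Set.right_mem_Icc.2 ht)
  simp only [mul_zero, neg_zero, flow_zero, one_apply_eq_self] at constant
  rw [← constant, ← flow_add_apply, add_neg_cancel, flow_zero, one_apply_eq_self]

theorem flow_apply_eigenvector {T : E →L[ℂ] E} {c : ℂ} {x : E} (h : T x = c • x) {τ : ℝ}
    (hτ : 0 ≤ τ) : flow T τ x = Complex.exp (τ * c) • x := by
  have solves (t : ℝ) : HasDerivAt (fun t : ℝ => Complex.exp (t * c) • x)
      ((1 : ℝ) • T (Complex.exp (t * c) • x)) t := by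
    refine ((((hasDerivAt_id (t : ℂ)).mul_const c).cexp).comp_ofReal.smul_const x).congr_deriv ?_
    rw [map_smul, h, one_smul, one_mul, smul_smul, id]
  have := eq_flow_of_hasDerivWithinAt (fun t _ => (solves t).hasDerivWithinAt) hτ
  simpa using this.symm

theorem apply_flow_eq_zero {T : E →L[ℂ] E} {l : E →L[ℂ] ℂ} {c : ℂ} (h : ∀ x, l (T x) = c * l x)
    {x : E} (hx : l x = 0) {τ : ℝ} (hτ : 0 ≤ τ) : l (flow T τ x) = 0 := by
  have solves (t : ℝ) : HasDerivAt (fun t => l (flow T t x))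
      ((1 : ℝ) • (c • (1 : ℂ →L[ℂ] ℂ)) (l (flow T t x))) t := by
    refine ((l.restrictScalars ℝ).hasFDerivAt.comp_hasDerivAt t
      (hasDerivAt_flow_apply_const T x t)).congr_deriv ?_
    simp [h]
  have := eq_flow_of_hasDerivWithinAt (fun t _ => (solves t).hasDerivWithinAt) hτ
  simpa [flow_zero, hx] using this

theorem norm_flow_le (T : E →L[ℂ] E) (τ : ℝ) : ‖flow T τ‖ ≤ Real.exp (|τ| * ‖T‖) := by
  have exp_series := NormedSpace.exp_series_hasSum_exp' (𝕂 := ℂ) ((τ : ℂ) • T)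
  have real_exp_series := NormedSpace.exp_series_hasSum_exp' (𝕂 := ℝ) (|τ| * ‖T‖)
  rw [← Real.exp_eq_exp_ℝ] at real_exp_series
  refine exp_series.norm_le_of_bounded real_exp_series fun n => ?_
  have norm_exponent : |τ| * ‖T‖ = ‖(τ : ℂ) • T‖ := by
    rw [norm_smul, Complex.norm_real, Real.norm_eq_abs]
  rw [norm_smul, norm_inv, RCLike.norm_natCast, smul_eq_mul, norm_exponent]
  gcongr
  exact norm_clm_pow_le _ n

theorem norm_flow_le_of_norm_le {T : E →L[ℂ] E} {R ν : ℝ} {n : ℕ} (hn : 0 < n) (hR : ‖T‖ ≤ R)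
    (hν : 0 ≤ ν) (hflow : ‖flow T n‖ ≤ Real.exp (-(ν * n))) {τ : ℝ} (hτ : 0 ≤ τ) :
    ‖flow T τ‖ ≤ Real.exp (n * (R + ν)) * Real.exp (-(ν * τ)) := by
  have hn0 : (0 : ℝ) < n := Nat.cast_pos.2 hn
  set m := ⌊τ / n⌋₊
  have floor_le : m * n ≤ τ := (le_div_iff₀ hn0).1 (Nat.floor_le (div_nonneg hτ hn0.le))
  have lt_floor : τ < (m + 1) * n := (div_lt_iff₀ hn0).1 (Nat.lt_floor_add_one (τ / n))
  have remainder : ‖flow T (τ - m * n)‖ ≤ Real.exp (n * R) := by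
    refine (norm_flow_le T _).trans (Real.exp_le_exp.2 ?_)
    rw [abs_of_nonneg (sub_nonneg.2 floor_le)]
    exact mul_le_mul (by linarith) hR (norm_nonneg _) hn0.le
  have periods : ‖flow T n ^ m‖ ≤ Real.exp (m * -(ν * n)) := by
    rw [Real.exp_nat_mul]
    exact (norm_clm_pow_le _ _).trans (by gcongr)
  rw [← sub_add_cancel τ (m * n), flow_add, flow_nat_mul]
  refine (norm_mul_le _ _).trans ((mul_le_mul remainder periods (norm_nonneg _)
    (Real.exp_pos _).le).trans ?_)
  rw [← Real.exp_add, ← Real.exp_add, sub_add_cancel]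
  refine Real.exp_le_exp.2 ?_
  nlinarith

section FiniteDimensional

variable [FiniteDimensional ℂ E]

theorem spectralRadius_flow_one_le {T : E →L[ℂ] E} {μ : ℝ}
    (hT : ∀ (c : ℂ) (x : E), x ≠ 0 → T x = c • x → c.re ≤ -μ) :
    spectralRadius ℂ (flow T 1) ≤ ENNReal.ofReal (Real.exp (-μ)) := by
  refine iSup₂_le fun k hk => ?_
  have coe_flow : Module.End.toContinuousLinearMap E (flow T 1 : E →ₗ[ℂ] E) = flow T 1 := rfl
  rw [← coe_flow, AlgEquiv.spectrum_eq, ← Module.End.hasEigenvalue_iff_mem_spectrum] at hk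
  -- `T` commutes with `e^T`, so it has an eigenvector inside the eigenspace of `e^T`.
  let F := Module.End.eigenspace (flow T 1 : E →ₗ[ℂ] E) k
  have mapsTo : ∀ x ∈ F, (T : E →ₗ[ℂ] E) x ∈ F := by
    intro x hx
    rw [Module.End.mem_eigenspace_iff, ContinuousLinearMap.coe_coe] at hx ⊢
    rw [ContinuousLinearMap.coe_coe, flow_apply_comm, hx, map_smul]
  have : Nontrivial F := Submodule.nontrivial_iff_ne_bot.2 hk
  obtain ⟨c, hc⟩ := Module.End.exists_eigenvalue ((T : E →ₗ[ℂ] E).restrict mapsTo)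
  obtain ⟨⟨x, hxF⟩, hx⟩ := hc.exists_hasEigenvector
  have x_ne_zero : x ≠ 0 := fun h => hx.2 (Subtype.ext h)
  have eigen : T x = c • x := congrArg Subtype.val hx.apply_eq_smul
  have flow_eigen : k • x = Complex.exp ((1 : ℝ) * c) • x :=
    (Module.End.mem_eigenspace_iff.1 hxF).symm.trans (flow_apply_eigenvector eigen zero_le_one)
  have k_eq : k = Complex.exp c := by simpa using smul_left_injective ℂ x_ne_zero flow_eigen
  rw [← enorm_eq_nnnorm, ← ofReal_norm, k_eq, Complex.norm_exp]
  exact ENNReal.ofReal_le_ofReal (Real.exp_le_exp.2 (hT c x x_ne_zero eigen))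

theorem exists_norm_flow_lt {T : E →L[ℂ] E} {μ ν : ℝ} (hν : ν < μ)
    (hT : ∀ (c : ℂ) (x : E), x ≠ 0 → T x = c • x → c.re ≤ -μ) :
    ∃ n : ℕ, 0 < n ∧ ‖flow T n‖ < Real.exp (-(ν * n)) := by
  have radius_lt : spectralRadius ℂ (flow T 1) < ENNReal.ofReal (Real.exp (-ν)) :=
    (spectralRadius_flow_one_le hT).trans_lt
      ((ENNReal.ofReal_lt_ofReal_iff (Real.exp_pos _)).2 (Real.exp_lt_exp.2 (neg_lt_neg hν)))
  obtain ⟨n, gelfand, hn⟩ := (((spectrum.pow_norm_pow_one_div_tendsto_nhds_spectralRadius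
    (flow T 1)).eventually_lt_const radius_lt).and (eventually_gt_atTop 0)).exists
  have hn0 : (0 : ℝ) < n := Nat.cast_pos.2 hn
  rw [ENNReal.ofReal_lt_ofReal_iff (Real.exp_pos _)] at gelfand
  have := Real.rpow_lt_rpow (by positivity) gelfand hn0
  rw [← Real.rpow_mul (norm_nonneg _), one_div_mul_cancel hn0.ne', Real.rpow_one,
    ← Real.exp_mul, ← flow_nat_mul, mul_one, neg_mul] at this
  exact ⟨n, hn, this⟩

theorem exists_eventually_norm_flow_le {T : E →L[ℂ] E} {μ ν : ℝ} (hν0 : 0 ≤ ν) (hν : ν < μ)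
    (hT : ∀ (c : ℂ) (x : E), x ≠ 0 → T x = c • x → c.re ≤ -μ) :
    ∃ C : ℝ, 0 ≤ C ∧ ∀ᶠ S in 𝓝 T, ∀ τ : ℝ, 0 ≤ τ → ‖flow S τ‖ ≤ C * Real.exp (-(ν * τ)) := by
  obtain ⟨n, hn, flow_lt⟩ := exists_norm_flow_lt hν hT
  refine ⟨Real.exp (n * (‖T‖ + 1 + ν)), (Real.exp_pos _).le, ?_⟩
  filter_upwards [(continuous_flow (n : ℝ)).norm.continuousAt.eventually_lt_const flow_lt,
    continuous_norm.continuousAt.eventually_lt_const (lt_add_one ‖T‖)] with S flow_S norm_S τ hτ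
  exact norm_flow_le_of_norm_le hn norm_S.le hν0 flow_S.le hτ

end FiniteDimensional

end Flow

/-! ### Dissipative operators -/

section Dissipative

open Filter

variable {E : Type*} [NormedAddCommGroup E] [InnerProductSpace ℂ E] [CompleteSpace E]
  {G : E →L[ℂ] E}

theorem norm_flow_apply_le (hG : ∀ x, (inner ℂ x (G x)).re ≤ 0) {τ : ℝ} (hτ : 0 ≤ τ) (x : E) :
    ‖flow G τ x‖ ≤ ‖x‖ := by
  have energy_deriv (σ : ℝ) : HasDerivAt (fun σ => ‖flow G σ x‖ ^ 2)
      (2 * (inner ℂ (flow G σ x) (G (flow G σ x))).re) σ := by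
    have flow_deriv := hasDerivAt_flow_apply_const G x σ
    refine ((Complex.reCLM.hasFDerivAt.comp_hasDerivAt σ
      (flow_deriv.inner ℂ flow_deriv)).congr_deriv ?_).congr_of_eventuallyEq
        (Eventually.of_forall fun s => ?_)
    · rw [map_add, Complex.reCLM_apply, Complex.reCLM_apply, ← inner_conj_symm (G (flow G σ x)),
        Complex.conj_re]
      ring
    · simpa using (inner_self_eq_norm_sq (𝕜 := ℂ) (flow G s x)).symm
  have energy_antitone : Antitone fun σ => ‖flow G σ x‖ ^ 2 :=
    antitone_of_deriv_nonpos (fun σ => (energy_deriv σ).differentiableAt) fun σ => by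
      rw [(energy_deriv σ).deriv]
      linarith [hG (flow G σ x)]
  have := energy_antitone hτ
  simp only [flow_zero, one_apply_eq_self] at this
  exact (pow_le_pow_iff_left₀ (norm_nonneg _) (norm_nonneg _) two_ne_zero).1 this

theorem norm_sub_flow_apply_le (hG : ∀ x, (inner ℂ x (G x)).re ≤ 0) {y y' : ℝ → E}
    (hy : ∀ t, HasDerivAt y (y' t) t) {B B' : ℝ → ℝ} (hB : ∀ t, HasDerivAt B (B' t) t)
    (hB0 : B 0 = 0) (bound : ∀ t, 0 ≤ t → ‖y' t - G (y t)‖ ≤ B' t) {τ : ℝ} (hτ : 0 ≤ τ) :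
    ‖y τ - flow G τ (y 0)‖ ≤ B τ := by
  -- Duhamel's formula: differentiate `σ ↦ e^{(τ - σ) G} (y σ)`.
  let F : ℝ → E := fun σ => flow G (τ - σ) (y σ)
  have F_deriv (σ : ℝ) : HasDerivAt F (flow G (τ - σ) (y' σ - G (y σ))) σ := by
    simpa [F, sub_eq_add_neg] using
      hasDerivAt_flow_apply G ((hasDerivAt_id σ).const_sub τ) (hy σ)
  have := image_norm_le_of_norm_deriv_right_le_deriv_boundary (a := 0) (b := τ)
    (fun σ _ => ((F_deriv σ).sub_const (F 0)).continuousAt.continuousWithinAt)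
    (fun σ _ => ((F_deriv σ).sub_const (F 0)).hasDerivWithinAt) (by simp [hB0]) hB
    (fun σ hσ => (norm_flow_apply_le hG (sub_nonneg.2 hσ.2.le) _).trans (bound σ hσ.1))
    (Set.right_mem_Icc.2 hτ)
  simpa [F, flow_zero] using this

theorem norm_sub_flow_apply_le_of_exp_bound (hG : ∀ x, (inner ℂ x (G x)).re ≤ 0) {y y' : ℝ → E}
    (hy : ∀ t, HasDerivAt y (y' t) t) {ν d : ℝ} (hν : 0 < ν)
    (bound : ∀ t, 0 ≤ t → ‖y' t - G (y t)‖ ≤ d * Real.exp (-(ν * t))) {τ : ℝ} (hτ : 0 ≤ τ) :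
    ‖y τ - flow G τ (y 0)‖ ≤ d / ν := by
  have primitive (t : ℝ) : HasDerivAt (fun t => d / ν - d / ν * Real.exp (-(ν * t)))
      (d * Real.exp (-(ν * t))) t := by
    refine ((((hasDerivAt_id t).const_mul ν).neg.exp.const_mul (d / ν)).const_sub
      (d / ν)).congr_deriv ?_
    field_simp
    rfl
  have hd : 0 ≤ d := by simpa using (norm_nonneg _).trans (bound 0 le_rfl)
  refine (norm_sub_flow_apply_le hG hy primitive (by simp) bound hτ).trans
    (sub_le_self _ (by positivity))

theorem norm_exp_smul_flow_sub_le (hG : ∀ x, (inner ℂ x (G x)).re ≤ 0) (θ : ℝ) (x : E) :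
    ‖Complex.exp (θ * Complex.I) • flow G 1 x - x‖ ≤ ‖G x + (θ * Complex.I) • x‖ := by
  -- Compare `e^{t G} x` with `e^{- i θ t} x`.
  have rotation (t : ℝ) : HasDerivAt (fun t : ℝ => Complex.exp (-(θ * Complex.I) * t) • x)
      ((Complex.exp (-(θ * Complex.I) * t) * -(θ * Complex.I)) • x) t := by
    simpa using
      (((hasDerivAt_id (t : ℂ)).const_mul (-(θ * Complex.I))).cexp).comp_ofReal.smul_const x
  have unimodular (t : ℝ) : ‖Complex.exp (-(θ * Complex.I) * t)‖ = 1 := by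
    rw [show -((θ : ℂ) * Complex.I) * t = ((-(θ * t) : ℝ) : ℂ) * Complex.I by push_cast; ring,
      Complex.norm_exp_ofReal_mul_I]
  have := norm_sub_flow_apply_le hG rotation
    (fun t => (hasDerivAt_id t).mul_const ‖G x + (θ * Complex.I) • x‖) (by simp)
    (fun t _ => le_of_eq ?_) zero_le_one
  · rw [norm_sub_rev, ← one_mul ‖_ - _‖, ← unimodular (-1), ← norm_smul, smul_sub, smul_smul,
      ← Complex.exp_add] at this
    simpa using this
  · rw [map_smul, mul_smul, ← smul_sub, norm_smul, unimodular, ← norm_neg]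
    congr 2
    module

end Dissipative

/-! ### Perturbation of a slow mode -/

section SlowMode

open Filter Topology Asymptotics

variable {E : Type*} [NormedAddCommGroup E]

section NormedSpace

variable [NormedSpace ℂ E]

/-- The projection along the mode `u` that is determined by a functional `l` with `l u = 1`. -/
def removeMode (l : E →L[ℂ] ℂ) (u : E) : E →L[ℂ] E := 1 - l.smulRight u

theorem removeMode_apply (l : E →L[ℂ] ℂ) (u x : E) : removeMode l u x = x - l x • u := rfl

theorem apply_removeMode {l : E →L[ℂ] ℂ} {u : E} (hlu : l u = 1) (x : E) :
    l (removeMode l u x) = 0 := by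
  rw [removeMode_apply, map_sub, map_smul, hlu, smul_eq_mul, mul_one, sub_self]

theorem removeMode_sub_smul {l : E →L[ℂ] ℂ} {u : E} (hlu : l u = 1) (x : E) (s : ℂ) :
    removeMode l u (x - s • u) = removeMode l u x := by
  rw [map_sub, map_smul, sub_eq_self, removeMode_apply, hlu, one_smul, sub_self, smul_zero]

theorem norm_apply_le_of_norm_sub_removeMode_le {l : E →L[ℂ] ℂ} {u : E} (hlu : l u = 1)
    {P : E →L[ℂ] E} {k d : ℝ} (hk : 0 ≤ k) (hd : 0 ≤ d) (hP : ‖P - removeMode l u‖ ≤ k * d) (x : E)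
    (s : ℂ) : ‖P x‖ ≤ (‖removeMode l u‖ + k) * (‖x - s • u‖ + d * ‖x‖) := by
  have split : P x = removeMode l u (x - s • u) + (P - removeMode l u) x := by
    rw [removeMode_sub_smul hlu, sub_apply, add_sub_cancel]
  rw [split]
  refine (norm_add_le _ _).trans ((add_le_add ((removeMode l u).le_opNorm _)
    ((P - removeMode l u).le_of_opNorm_le hP x)).trans ?_)
  have : 0 ≤ ‖removeMode l u‖ * (d * ‖x‖) + k * ‖x - s • u‖ := by positivity
  linarith

/-- The operator `G` with its slow mode `u` damped at rate `μ`: off the mode it is the compression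
of `G` to the kernel of `l`, and `l` becomes a left eigenvector with eigenvalue `-μ`. -/
def dampedOp (μ : ℝ) (G : E →L[ℂ] E) (l : E →L[ℂ] ℂ) (u : E) : E →L[ℂ] E :=
  removeMode l u ∘L G - (μ : ℂ) • l.smulRight u

theorem dampedOp_apply (μ : ℝ) (G : E →L[ℂ] E) (l : E →L[ℂ] ℂ) (u x : E) :
    dampedOp μ G l u x = G x - (l (G x) + μ * l x) • u := by
  rw [dampedOp, sub_apply, ContinuousLinearMap.comp_apply, removeMode_apply, smul_apply,
    ContinuousLinearMap.smulRight_apply]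
  module

theorem apply_dampedOp {l : E →L[ℂ] ℂ} {u : E} (hlu : l u = 1) (μ : ℝ) (G : E →L[ℂ] E) (x : E) :
    l (dampedOp μ G l u x) = -μ * l x := by
  rw [dampedOp_apply, map_sub, map_smul, hlu, smul_eq_mul]
  ring

theorem dampedOp_eigenvalue_re_le {l : E →L[ℂ] ℂ} {u : E} (hlu : l u = 1) {μ : ℝ} {G : E →L[ℂ] E}
    (hlG : ∀ x, l (G x) = 0) (hker : ∀ x, G x = 0 → l x = 0 → x = 0)
    (hspec : ∀ (c : ℂ) (x : E), x ≠ 0 → c ≠ 0 → G x = c • x → c.re ≤ -μ)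
    {c : ℂ} {x : E} (hx : x ≠ 0) (eigen : dampedOp μ G l u x = c • x) : c.re ≤ -μ := by
  have eigen_l := apply_dampedOp hlu μ G x
  rw [eigen, map_smul, smul_eq_mul] at eigen_l
  by_cases hl : l x = 0
  · rw [dampedOp_apply, hlG, hl, mul_zero, add_zero, zero_smul, sub_zero] at eigen
    exact hspec c x hx (fun hc => hx (hker x (by rw [eigen, hc, zero_smul]) hl)) eigen
  · rw [mul_right_cancel₀ hl eigen_l, Complex.neg_re, Complex.ofReal_re]

theorem continuousAt_dampedOp (μ : ℝ) {G : ℝ → E →L[ℂ] E} {l : ℝ → E →L[ℂ] ℂ} {u : ℝ → E} {θ : ℝ}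
    (hG : ContinuousAt G θ) (hl : ContinuousAt l θ) (hu : ContinuousAt u θ) :
    ContinuousAt (fun θ => dampedOp μ (G θ) (l θ) (u θ)) θ := by
  have rank_one : ContinuousAt (fun θ => (l θ).smulRight (u θ)) θ :=
    isBoundedBilinearMap_smulRight.continuous.continuousAt.comp (hl.prodMk hu)
  exact ((continuousAt_const.sub rank_one).clm_comp hG).sub (rank_one.fun_const_smul _)

theorem differentiableAt_removeMode {l : ℝ → E →L[ℂ] ℂ} {u : ℝ → E} {θ : ℝ}
    (hl : DifferentiableAt ℝ l θ) (hu : DifferentiableAt ℝ u θ) :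
    DifferentiableAt ℝ (fun θ => removeMode (l θ) (u θ)) θ := by
  have rank_one : DifferentiableAt ℝ (fun θ => (l θ).smulRight (u θ)) θ :=
    DifferentiableAt.comp (g := fun q : (E →L[ℂ] ℂ) × E => q.1.smulRight q.2) θ
      ((isBoundedBilinearMap_smulRight.differentiableAt (l θ, u θ)).restrictScalars ℝ)
      (hl.prodMk hu)
  exact rank_one.const_sub 1

/-- The functional with value `1` at `u` that a bilinear form `b` with `b u u ≠ 0` provides. -/
def modeFunctional (b : E →L[ℂ] E →L[ℂ] ℂ) (u : E) : E →L[ℂ] ℂ := (b u u)⁻¹ • b u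

theorem modeFunctional_self {b : E →L[ℂ] E →L[ℂ] ℂ} {u : E} (hu : b u u ≠ 0) :
    modeFunctional b u u = 1 :=
  inv_mul_cancel₀ hu

theorem modeFunctional_comp_add_smul {b : E →L[ℂ] E →L[ℂ] ℂ} {G : E →L[ℂ] E}
    (hb : ∀ x y, b (G x) y = b x (G y)) (u : E) (z : ℂ) :
    modeFunctional b u ∘L G + z • modeFunctional b u = (b u u)⁻¹ • b (G u + z • u) := by
  ext x
  simp only [modeFunctional, add_apply, smul_apply, ContinuousLinearMap.comp_apply, map_add,
    map_smul, hb, smul_eq_mul]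
  ring

/-- The defect of the time-one flow of `G` from being the rotation `e^{-iθ}`. -/
def shiftDefect (G : E →L[ℂ] E) (θ : ℝ) : E →L[ℂ] E :=
  Complex.exp (θ * Complex.I) • flow G 1 - 1

theorem shiftDefect_apply (G : E →L[ℂ] E) (θ : ℝ) (x : E) :
    shiftDefect G θ x = Complex.exp (θ * Complex.I) • flow G 1 x - x := rfl

theorem flow_shiftDefect [CompleteSpace E] (G : E →L[ℂ] E) (θ τ : ℝ) (x : E) :
    flow G τ (shiftDefect G θ x) = shiftDefect G θ (flow G τ x) := by
  rw [shiftDefect_apply, shiftDefect_apply, map_sub, map_smul, ← flow_add_apply, add_comm,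
    flow_add_apply]

end NormedSpace

variable [InnerProductSpace ℂ E] [CompleteSpace E]

theorem norm_shiftDefect_apply_le {G : E →L[ℂ] E} (hG : ∀ x, (inner ℂ x (G x)).re ≤ 0) (θ : ℝ)
    (x : E) : ‖shiftDefect G θ x‖ ≤ 2 * ‖x‖ := by
  rw [shiftDefect_apply]
  refine (norm_sub_le _ _).trans ?_
  rw [norm_smul, Complex.norm_exp_ofReal_mul_I, one_mul, two_mul]
  gcongr
  exact norm_flow_apply_le hG zero_le_one x

theorem norm_flow_apply_le_of_apply_eq_zero {G : E →L[ℂ] E} {l : E →L[ℂ] ℂ} {u : E}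
    (hG : ∀ x, (inner ℂ x (G x)).re ≤ 0) (hlu : l u = 1) {μ ν c : ℝ} (hν : 0 < ν)
    (hflow : ∀ τ : ℝ, 0 ≤ τ → ‖flow (dampedOp μ G l u) τ‖ ≤ c * Real.exp (-(ν * τ)))
    (z : ℂ) {x : E} (hx : l x = 0) {τ : ℝ} (hτ : 0 ≤ τ) :
    ‖flow G τ x‖ ≤ c * Real.exp (-(ν * τ)) * ‖x‖ + ‖l ∘L G + z • l‖ * ‖u‖ * c * ‖x‖ / ν := by
  let T := dampedOp μ G l u
  have damped_decay (t : ℝ) (ht : 0 ≤ t) : ‖flow T t x‖ ≤ c * Real.exp (-(ν * t)) * ‖x‖ :=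
    ((flow T t).le_opNorm x).trans (mul_le_mul_of_nonneg_right (hflow t ht) (norm_nonneg _))
  have perturbation (t : ℝ) (ht : 0 ≤ t) : T (flow T t x) - G (flow T t x) =
      -((l ∘L G + z • l) (flow T t x) • u) := by
    have hl : l (flow T t x) = 0 := apply_flow_eq_zero (apply_dampedOp hlu μ G) hx ht
    rw [dampedOp_apply, hl, add_apply, smul_apply, hl, ContinuousLinearMap.comp_apply]
    module
  have difference := norm_sub_flow_apply_le_of_exp_bound hG (hasDerivAt_flow_apply_const T x) hν
    (d := ‖l ∘L G + z • l‖ * ‖u‖ * c * ‖x‖) (fun t ht => ?_) hτ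
  · rw [flow_zero, one_apply_eq_self, norm_sub_rev] at difference
    exact norm_le_insert' _ _ |>.trans (add_le_add (damped_decay τ hτ) difference)
  · rw [perturbation t ht, norm_neg, norm_smul]
    calc _ ≤ ‖l ∘L G + z • l‖ * (c * Real.exp (-(ν * t)) * ‖x‖) * ‖u‖ := by
          gcongr
          exact ContinuousLinearMap.le_opNorm_of_le _ (damped_decay t ht)
      _ = _ := by ring

theorem norm_flow_shiftDefect_le {G : E →L[ℂ] E} {l : E →L[ℂ] ℂ} {u : E}
    (hG : ∀ x, (inner ℂ x (G x)).re ≤ 0) (hlu : l u = 1) {μ ν c : ℝ} (hν : 0 < ν)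
    (hflow : ∀ τ : ℝ, 0 ≤ τ → ‖flow (dampedOp μ G l u) τ‖ ≤ c * Real.exp (-(ν * τ)))
    (θ : ℝ) {τ : ℝ} (hτ : 0 ≤ τ) (x : E) :
    ‖flow G τ (shiftDefect G θ x)‖ ≤
      ‖l x‖ * ‖G u + (θ * Complex.I) • u‖ +
        2 * (c * Real.exp (-(ν * τ)) * ‖removeMode l u x‖ +
          ‖l ∘L G + (θ * Complex.I) • l‖ * ‖u‖ * c * ‖removeMode l u x‖ / ν) := by
  have split : flow G τ (shiftDefect G θ x) =
      l x • flow G τ (shiftDefect G θ u) + shiftDefect G θ (flow G τ (removeMode l u x)) := by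
    rw [← flow_shiftDefect, ← map_smul, ← map_smul, ← map_add, ← map_add, removeMode_apply,
      add_sub_cancel]
  have slow : ‖flow G τ (shiftDefect G θ u)‖ ≤ ‖G u + (θ * Complex.I) • u‖ :=
    (norm_flow_apply_le hG hτ _).trans (norm_exp_smul_flow_sub_le hG θ u)
  rw [split]
  refine (norm_add_le _ _).trans (add_le_add ?_ ?_)
  · rw [norm_smul]
    gcongr
  · refine (norm_shiftDefect_apply_le hG θ _).trans ?_
    gcongr
    exact norm_flow_apply_le_of_apply_eq_zero hG hlu hν hflow _ (apply_removeMode hlu x) hτ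

theorem norm_flow_shiftDefect_le_residual {G : E →L[ℂ] E} {l : E →L[ℂ] ℂ} {u : E}
    (hG : ∀ x, (inner ℂ x (G x)).re ≤ 0) (hlu : l u = 1) {μ ν c : ℝ} (hν : 0 < ν) (hc : 0 ≤ c)
    (hflow : ∀ τ : ℝ, 0 ≤ τ → ‖flow (dampedOp μ G l u) τ‖ ≤ c * Real.exp (-(ν * τ)))
    (θ : ℝ) {τ : ℝ} (hτ : 0 ≤ τ) (x : E) :
    ‖flow G τ (shiftDefect G θ x)‖ ≤
      (‖l‖ * ‖G u + (θ * Complex.I) • u‖ +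
        2 * (‖u‖ * c * ‖removeMode l u‖ / ν) * ‖l ∘L G + (θ * Complex.I) • l‖) * ‖x‖ +
        2 * c * Real.exp (-(ν * τ)) * ‖removeMode l u x‖ := by
  calc ‖flow G τ (shiftDefect G θ x)‖
      ≤ _ := norm_flow_shiftDefect_le hG hlu hν hflow θ hτ x
    _ ≤ ‖l‖ * ‖x‖ * ‖G u + (θ * Complex.I) • u‖ +
        2 * (c * Real.exp (-(ν * τ)) * ‖removeMode l u x‖ +
          ‖l ∘L G + (θ * Complex.I) • l‖ * ‖u‖ * c * (‖removeMode l u‖ * ‖x‖) / ν) := by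
        gcongr
        exacts [l.le_opNorm x, (removeMode l u).le_opNorm x]
    _ = _ := by ring

theorem exists_eventually_norm_flow_shiftDefect_le [FiniteDimensional ℂ E] {G : ℝ → E →L[ℂ] E}
    {l : ℝ → E →L[ℂ] ℂ} {u : ℝ → E} {μ ν : ℝ} {q : ℕ} (hν : 0 < ν) (hνμ : ν < μ)
    (hGc : ContinuousAt G 0) (hG : ∀ θ x, (inner ℂ x (G θ x)).re ≤ 0)
    (hl : DifferentiableAt ℝ l 0) (hu : DifferentiableAt ℝ u 0) (hlu : ∀ᶠ θ in 𝓝 0, l θ (u θ) = 1)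
    (right_residual :
      (fun θ : ℝ => G θ (u θ) + (θ * Complex.I) • u θ) =O[𝓝 0] fun θ : ℝ => θ ^ q)
    (left_residual :
      (fun θ : ℝ => l θ ∘L G θ + (θ * Complex.I) • l θ) =O[𝓝 0] fun θ : ℝ => θ ^ q)
    (hspec : ∀ (c : ℂ) (x : E), x ≠ 0 → dampedOp μ (G 0) (l 0) (u 0) x = c • x → c.re ≤ -μ) :
    ∃ C : ℝ, 0 ≤ C ∧ ∀ᶠ θ : ℝ in 𝓝 0, ∀ τ : ℝ, 0 ≤ τ → ∀ (x : E) (s : ℂ),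
      ‖flow (G θ) τ (shiftDefect (G θ) θ x)‖ ≤
        C * (|θ| ^ q * ‖x‖ + Real.exp (-(ν * τ)) * (‖x - s • u 0‖ + |θ| * ‖x‖)) := by
  obtain ⟨c, hc, damped_decay⟩ := exists_eventually_norm_flow_le hν.le hνμ hspec
  let P (θ : ℝ) := removeMode (l θ) (u θ)
  have P_diff : DifferentiableAt ℝ P 0 := differentiableAt_removeMode hl hu
  obtain ⟨k, hk, P_sub⟩ := P_diff.isBigO_sub.exists_nonneg
  have hlu0 : l 0 (u 0) = 1 := hlu.self_of_nhds
  have factor : ContinuousAt (fun θ => 2 * (‖u θ‖ * c * ‖P θ‖ / ν)) 0 := by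
    have := P_diff.continuousAt
    have := hu.continuousAt
    fun_prop
  have residual : (fun θ => ‖l θ‖ * ‖G θ (u θ) + (θ * Complex.I) • u θ‖ +
      2 * (‖u θ‖ * c * ‖P θ‖ / ν) * ‖l θ ∘L G θ + (θ * Complex.I) • l θ‖) =O[𝓝 0]
      fun θ : ℝ => 1 * θ ^ q :=
    ((hl.continuousAt.norm.tendsto.isBigO_one ℝ).mul right_residual.norm_left).add
      ((factor.tendsto.isBigO_one ℝ).mul left_residual.norm_left)
  obtain ⟨r, hr, residual_le⟩ := residual.exists_nonneg
  refine ⟨r + 2 * c * (‖P 0‖ + k), by positivity, ?_⟩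
  filter_upwards [(continuousAt_dampedOp μ hGc hl.continuousAt hu.continuousAt).eventually
    damped_decay, P_sub.bound, residual_le.bound, hlu] with θ decay P_sub residual_le hlu τ hτ x s
  rw [Real.norm_of_nonneg (by positivity), one_mul, norm_pow, Real.norm_eq_abs] at residual_le
  rw [sub_zero, Real.norm_eq_abs] at P_sub
  calc ‖flow (G θ) τ (shiftDefect (G θ) θ x)‖
      ≤ _ := norm_flow_shiftDefect_le_residual (hG θ) hlu hν hc decay θ hτ x
    _ ≤ r * |θ| ^ q * ‖x‖ +
        2 * c * Real.exp (-(ν * τ)) * ((‖P 0‖ + k) * (‖x - s • u 0‖ + |θ| * ‖x‖)) := by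
        gcongr
        exact norm_apply_le_of_norm_sub_removeMode_le hlu0 hk (abs_nonneg θ) P_sub x s
    _ ≤ _ := by
        have : 0 ≤ r * (Real.exp (-(ν * τ)) * (‖x - s • u 0‖ + |θ| * ‖x‖)) +
          2 * c * (‖P 0‖ + k) * (|θ| ^ q * ‖x‖) := by positivity
        linarith

theorem exists_eventually_norm_flow_shiftDefect_le_of_symm [FiniteDimensional ℂ E]
    {b : E →L[ℂ] E →L[ℂ] ℂ} {G : ℝ → E →L[ℂ] E} {u : ℝ → E} {μ ν : ℝ} {q : ℕ} (hν : 0 < ν)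
    (hνμ : ν < μ) (hGc : ContinuousAt G 0) (hG : ∀ θ x, (inner ℂ x (G θ x)).re ≤ 0)
    (hb : ∀ θ x y, b (G θ x) y = b x (G θ y)) (hu : DifferentiableAt ℝ u 0)
    (residual : (fun θ : ℝ => G θ (u θ) + (θ * Complex.I) • u θ) =O[𝓝 0] fun θ : ℝ => θ ^ q)
    (hGu : G 0 (u 0) = 0) (hbu : b (u 0) (u 0) ≠ 0)
    (hker : ∀ x, G 0 x = 0 → b (u 0) x = 0 → x = 0)
    (hspec : ∀ (c : ℂ) (x : E), x ≠ 0 → c ≠ 0 → G 0 x = c • x → c.re ≤ -μ) :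
    ∃ C : ℝ, 0 ≤ C ∧ ∀ᶠ θ : ℝ in 𝓝 0, ∀ τ : ℝ, 0 ≤ τ → ∀ (x : E) (s : ℂ),
      ‖flow (G θ) τ (shiftDefect (G θ) θ x)‖ ≤
        C * (|θ| ^ q * ‖x‖ + Real.exp (-(ν * τ)) * (‖x - s • u 0‖ + |θ| * ‖x‖)) := by
  have b_diff : DifferentiableAt ℝ (fun θ => b (u θ)) 0 :=
    ((b.restrictScalars ℝ).differentiableAt).comp 0 hu
  have pairing_diff : DifferentiableAt ℝ (fun θ => b (u θ) (u θ)) 0 :=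
    DifferentiableAt.comp (g := fun r : (E →L[ℂ] ℂ) × E => r.1 r.2) 0
      ((isBoundedBilinearMap_apply.differentiableAt (b (u 0), u 0)).restrictScalars ℝ)
      (b_diff.prodMk hu)
  have inv_diff := pairing_diff.inv hbu
  have b_residual := (b.isBigO_comp _ _).trans residual
  refine exists_eventually_norm_flow_shiftDefect_le (l := fun θ => modeFunctional b (u θ)) hν hνμ
    hGc hG (inv_diff.smul b_diff) hu
    ((pairing_diff.continuousAt.eventually_ne hbu).mono fun θ => modeFunctional_self) residual ?_
    fun c x hx => dampedOp_eigenvalue_re_le (modeFunctional_self hbu) ?_ ?_ hspec hx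
  · simp only [modeFunctional_comp_add_smul (hb _)]
    exact ((inv_diff.continuousAt.tendsto.isBigO_one ℝ).smul b_residual).congr_right
      fun θ => one_smul ℝ _
  · intro x
    rw [modeFunctional, smul_apply, ← hb, hGu, map_zero, zero_apply, smul_zero]
  · intro x hGx hlx
    exact hker x hGx ((smul_eq_zero.1 hlx).resolve_left (inv_ne_zero hbu))

theorem exists_norm_flow_shiftDefect_le {G : ℝ → E →L[ℂ] E} {u : E} {ν C : ℝ} {q : ℕ}
    (hG : ∀ θ x, (inner ℂ x (G θ x)).re ≤ 0) (hC : 0 ≤ C)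
    (near_zero : ∀ᶠ θ : ℝ in 𝓝 0, ∀ τ : ℝ, 0 ≤ τ → ∀ (x : E) (s : ℂ),
      ‖flow (G θ) τ (shiftDefect (G θ) θ x)‖ ≤
        C * (|θ| ^ q * ‖x‖ + Real.exp (-(ν * τ)) * (‖x - s • u‖ + |θ| * ‖x‖))) :
    ∃ K : ℝ, 0 ≤ K ∧ ∀ θ τ : ℝ, 0 ≤ τ → ∀ (x : E) (s : ℂ),
      ‖flow (G θ) τ (shiftDefect (G θ) θ x)‖ ≤
        K * (|θ| ^ q * ‖x‖ + Real.exp (-(ν * τ)) * (‖x - s • u‖ + |θ| * ‖x‖)) := by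
  obtain ⟨δ, hδ, near_zero⟩ := Metric.eventually_nhds_iff.1 near_zero
  refine ⟨C + 2 * δ⁻¹ ^ q, by positivity, fun θ τ hτ x s => ?_⟩
  rw [add_mul]
  rcases lt_or_ge |θ| δ with small | large
  · exact (near_zero (by simpa using small) τ hτ x s).trans
      (le_add_of_nonneg_right (by positivity))
  · have one_le : 1 ≤ δ⁻¹ ^ q * |θ| ^ q := by
      rw [← mul_pow]
      exact one_le_pow₀ (by rwa [inv_mul_eq_div, one_le_div hδ])
    calc ‖flow (G θ) τ (shiftDefect (G θ) θ x)‖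
        ≤ 2 * (1 * ‖x‖) := by
          rw [one_mul]
          exact (norm_flow_apply_le (hG θ) hτ _).trans (norm_shiftDefect_apply_le (hG θ) θ x)
      _ ≤ 2 * (δ⁻¹ ^ q * |θ| ^ q * ‖x‖) := by gcongr
      _ = 2 * δ⁻¹ ^ q * (|θ| ^ q * ‖x‖ + 0) := by ring
      _ ≤ 2 * δ⁻¹ ^ q *
          (|θ| ^ q * ‖x‖ + Real.exp (-(ν * τ)) * (‖x - s • u‖ + |θ| * ‖x‖)) := by
          gcongr
          positivity
      _ ≤ _ := le_add_of_nonneg_left (by positivity)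

end SlowMode

/-! ### Advection of a single Fourier mode -/

/-- The upwind operator, in units of `a / h`, on the Fourier mode with phase `θ` per cell. -/
def blochOp (p : ℕ) (θ : ℝ) : Cell p →L[ℂ] Cell p := upwind p (Complex.exp (-θ * Complex.I))

theorem blochOp_zero (p : ℕ) : blochOp p 0 = upwind p 1 := by
  simp [blochOp]

theorem continuous_blochOp (p : ℕ) : Continuous (blochOp p) := by
  unfold blochOp upwind
  fun_prop

theorem re_inner_blochOp_nonpos (p : ℕ) (θ : ℝ) (x : Cell p) : (inner ℂ x (blochOp p θ x)).re ≤ 0 :=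
  re_inner_upwind_nonpos p (by simpa using Complex.norm_exp_ofReal_mul_I (-θ)) x

/-- The constant function `1` on the cell. -/
def Cell.one (p : ℕ) : Cell p := ⟨C 1, mem_degreeLT_add_one.2 (by simp)⟩

theorem Cell.eq_smul_one {p : ℕ} {x : Cell p} {c : ℂ} (hx : (x : ℂ[X]) = C c) :
    x = c • Cell.one p :=
  Subtype.ext (by rw [hx, Submodule.coe_smul, Cell.one, smul_C, smul_eq_mul, mul_one])

theorem blochOp_zero_mode_zero (p : ℕ) : blochOp p 0 (mode p 0) = 0 := by
  obtain ⟨d, -, hd⟩ := exists_mode_zero_eq_C p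
  ext1
  simp [blochOp_zero, coe_upwind, hd]

theorem differentiableAt_mode_ofReal_mul_I (p : ℕ) (θ : ℝ) :
    DifferentiableAt ℝ (fun θ : ℝ => mode p (θ * Complex.I)) θ :=
  DifferentiableAt.comp (g := mode p) θ ((differentiable_mode p _).restrictScalars ℝ)
    (Complex.ofRealCLM.differentiableAt.mul_const _)

open Filter Topology Asymptotics in
theorem isBigO_blochOp_mode_residual (p : ℕ) :
    (fun θ : ℝ => blochOp p θ (mode p (θ * Complex.I)) +
      (θ * Complex.I) • mode p (θ * Complex.I)) =O[𝓝 0] fun θ : ℝ => θ ^ (2 * p + 2) := by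
  obtain ⟨c, -, pade⟩ := exists_norm_gPoly_sub_exp_mul_fPoly_le p
  refine IsBigO.of_bound (c * ‖inflowDelta p‖) ?_
  filter_upwards [Metric.closedBall_mem_nhds (0 : ℝ) one_pos] with θ hθ
  have norm_eq : ‖(θ : ℂ) * Complex.I‖ = ‖θ‖ := by simp
  have pade_θ := pade (θ * Complex.I) (by rwa [norm_eq, ← mem_closedBall_zero_iff])
  rw [norm_eq, ← neg_mul, norm_sub_rev] at pade_θ
  rw [blochOp, upwind_mode, neg_add_cancel_comm, norm_smul, norm_pow, mul_right_comm]
  gcongr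

theorem exists_norm_flow_blochOp_shiftDefect_le (p : ℕ) {μ ν : ℝ} (hν : 0 < ν) (hνμ : ν < μ)
    (hμ : ∀ z : ℂ, IsNonphysicalRoot p z → μ ≤ z.re) :
    ∃ K : ℝ, 0 ≤ K ∧ ∀ θ τ : ℝ, 0 ≤ τ → ∀ (x : Cell p) (s : ℂ),
      ‖flow (blochOp p θ) τ (shiftDefect (blochOp p θ) θ x)‖ ≤
        K * (|θ| ^ (2 * p + 2) * ‖x‖ +
          Real.exp (-(ν * τ)) * (‖x - s • Cell.one p‖ + |θ| * ‖x‖)) := by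
  obtain ⟨d, hd, mode_zero⟩ := exists_mode_zero_eq_C p
  obtain ⟨C, hC, near_zero⟩ := exists_eventually_norm_flow_shiftDefect_le_of_symm
    (u := fun θ => mode p (θ * Complex.I)) hν hνμ (continuous_blochOp p).continuousAt
    (re_inner_blochOp_nonpos p) (fun θ => reflectForm_upwind p _)
    (differentiableAt_mode_ofReal_mul_I p 0) (isBigO_blochOp_mode_residual p)
    (by simpa using blochOp_zero_mode_zero p)
    (by simpa using reflectForm_ne_zero_of_eq_C hd hd mode_zero mode_zero)
    (fun x hx hbx => by
      rw [blochOp_zero] at hx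
      rw [Complex.ofReal_zero, zero_mul] at hbx
      obtain ⟨e, he⟩ := exists_eq_C_of_upwind_eq_zero hx
      by_cases he0 : e = 0
      · rw [Cell.eq_smul_one he, he0, zero_smul]
      · exact absurd hbx (reflectForm_ne_zero_of_eq_C hd he0 mode_zero he))
    (fun c x hx hc eigen => by
      rw [blochOp_zero] at eigen
      have := hμ (-c) (isNonphysicalRoot_of_upwind_eq hx (neg_ne_zero.2 hc) (by simpa using eigen))
      rw [Complex.neg_re] at this
      linarith)
  refine exists_norm_flow_shiftDefect_le (re_inner_blochOp_nonpos p) hC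
    (near_zero.mono fun θ bound τ hτ x s => ?_)
  have scaled : (s * d⁻¹) • mode p ((0 : ℝ) * Complex.I) = s • Cell.one p := by
    rw [Complex.ofReal_zero, zero_mul, Cell.eq_smul_one mode_zero, smul_smul,
      inv_mul_cancel_right₀ hd]
  simpa only [scaled] using bound τ hτ x (s * d⁻¹)

/-! ### Grid modes of periodic sequences -/

/-- The phase `2πn/N`, in `[-π, π]`, by which the grid mode `n` advances from one cell to the
next. -/
def modeAngle {N : ℕ} (n : ZMod N) : ℝ := 2 * Real.pi * n.valMinAbs / N

theorem abs_modeAngle {N : ℕ} (n : ZMod N) :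
    |modeAngle n| = 2 * Real.pi * |(n.valMinAbs : ℝ)| / N := by
  rw [modeAngle, abs_div, abs_mul, abs_of_pos Real.two_pi_pos, Nat.abs_cast]

section ModeAngle

variable {N : ℕ} [NeZero N]

theorem abs_modeAngle_le_pi (n : ZMod N) : |modeAngle n| ≤ Real.pi := by
  have hN : (0 : ℝ) < N := Nat.cast_pos.2 (NeZero.pos N)
  obtain ⟨lower, upper⟩ := n.valMinAbs_mem_Ioc
  have two_mul_le : |(n.valMinAbs : ℝ)| * 2 ≤ N := by
    rw [← abs_two, ← abs_mul, abs_le]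
    exact ⟨by exact_mod_cast lower.le, by exact_mod_cast upper⟩
  rw [abs_modeAngle, div_le_iff₀ hN]
  nlinarith [Real.pi_pos]

theorem stdAddChar_eq_exp_modeAngle (n : ZMod N) :
    ZMod.stdAddChar n = Complex.exp (modeAngle n * Complex.I) := by
  conv_lhs => rw [← ZMod.coe_valMinAbs n]
  rw [ZMod.stdAddChar_coe, modeAngle]
  push_cast
  ring_nf

theorem stdAddChar_neg_eq_exp_modeAngle (n : ZMod N) :
    ZMod.stdAddChar (-n) = Complex.exp (-modeAngle n * Complex.I) := by
  rw [AddChar.map_neg_eq_inv, stdAddChar_eq_exp_modeAngle, ← Complex.exp_neg, neg_mul]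

theorem le_norm_stdAddChar_neg_sub_one (n : ZMod N) :
    4 * |(n.valMinAbs : ℝ)| / N ≤ ‖(ZMod.stdAddChar (-n) : ℂ) - 1‖ := by
  have norm_eq : ‖(ZMod.stdAddChar (-n) : ℂ) - 1‖ = ‖2 * Real.sin (-modeAngle n / 2)‖ := by
    rw [← Complex.norm_exp_I_mul_ofReal_sub_one, stdAddChar_neg_eq_exp_modeAngle,
      mul_comm Complex.I, Complex.ofReal_neg]
  have jordan := Real.mul_abs_le_abs_sin (x := -modeAngle n / 2) (by
    rw [abs_div, abs_neg, abs_two]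
    linarith [abs_modeAngle_le_pi n])
  rw [abs_div, abs_neg, abs_two, abs_modeAngle] at jordan
  rw [norm_eq, norm_mul, Real.norm_eq_abs, Real.norm_eq_abs, abs_two]
  calc 4 * |(n.valMinAbs : ℝ)| / N
      = 2 * (2 / Real.pi * (2 * Real.pi * |(n.valMinAbs : ℝ)| / N / 2)) := by
        field_simp
        ring
    _ ≤ 2 * |Real.sin (-modeAngle n / 2)| := by gcongr

end ModeAngle

section ModeCoeff

variable {N : ℕ} [NeZero N] {E F : Type*} [NormedAddCommGroup E] [NormedSpace ℂ E]
  [NormedAddCommGroup F] [NormedSpace ℂ F]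

/-- The coefficient of the grid mode `n` of an `N`-periodic sequence: its discrete Fourier
transform, normalised by `1 / N`. -/
def modeCoeff (X : ℤ → E) (n : ZMod N) : E :=
  (N : ℂ)⁻¹ • ZMod.dft (fun j : ZMod N => X j.val) n

theorem modeCoeff_eq_sum (X : ℤ → E) (n : ZMod N) :
    modeCoeff X n = (N : ℂ)⁻¹ • ∑ j : ZMod N, ZMod.stdAddChar (-(j * n)) • X j.val := by
  rw [modeCoeff, ZMod.dft_apply]

theorem apply_val_intCast {α : Type*} {X : ℤ → α} (hX : Function.Periodic X N) (k : ℤ) :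
    X ((k : ZMod N).val) = X k := by
  have periodic := hX.int_mul (k / N) (k % N)
  rw [Int.cast_id, mul_comm, Int.emod_add_mul_ediv] at periodic
  rw [ZMod.val_intCast, periodic]

theorem sum_smul_modeCoeff {X : ℤ → E} (hX : Function.Periodic X N) (k : ℤ) :
    ∑ n : ZMod N, ZMod.stdAddChar ((k : ZMod N) * n) • modeCoeff X n = X k := by
  have inversion := congrFun (ZMod.dft.symm_apply_apply fun j : ZMod N => X j.val) k
  rw [ZMod.invDFT_apply, apply_val_intCast hX, Finset.smul_sum] at inversion
  rw [← inversion]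
  exact Finset.sum_congr rfl fun n _ => by rw [modeCoeff, smul_comm, mul_comm]

theorem modeCoeff_shift {X : ℤ → E} (hX : Function.Periodic X N) (n : ZMod N) :
    modeCoeff (fun j => X (j - 1)) n = ZMod.stdAddChar (-n) • modeCoeff X n := by
  have shift_val (j : ZMod N) : X ((j.val : ℤ) - 1) = X ((j - 1).val) := by
    rw [← apply_val_intCast hX]
    simp
  rw [modeCoeff_eq_sum, modeCoeff_eq_sum, smul_comm (ZMod.stdAddChar (-n) : ℂ),
    ← Equiv.sum_comp (Equiv.addRight (1 : ZMod N))
      fun j => ZMod.stdAddChar (-(j * n)) • X ((j.val : ℤ) - 1)]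
  congr 1
  rw [Finset.smul_sum]
  refine Finset.sum_congr rfl fun j _ => ?_
  rw [shift_val, Equiv.coe_addRight, add_sub_cancel_right, smul_smul, ← AddChar.map_add_eq_mul,
    add_mul, one_mul, neg_add_rev]

theorem norm_modeCoeff_le {X : ℤ → E} {b : ℝ} (hX : ∀ j, ‖X j‖ ≤ b) (n : ZMod N) :
    ‖modeCoeff X n‖ ≤ b := by
  have hN : (0 : ℝ) < N := Nat.cast_pos.2 (NeZero.pos N)
  rw [modeCoeff_eq_sum, norm_smul, norm_inv, RCLike.norm_natCast, inv_mul_le_iff₀ hN]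
  calc ‖∑ j : ZMod N, ZMod.stdAddChar (-(j * n)) • X j.val‖ ≤ ∑ _j : ZMod N, b :=
        norm_sum_le_of_le _ fun j _ => by
          rw [norm_smul, AddChar.norm_apply, one_mul]
          exact hX _
    _ = N * b := by simp

theorem modeCoeff_add (X Y : ℤ → E) (n : ZMod N) :
    modeCoeff (fun j => X j + Y j) n = modeCoeff X n + modeCoeff Y n := by
  simp [modeCoeff_eq_sum, Finset.sum_add_distrib]

theorem modeCoeff_sub (X Y : ℤ → E) (n : ZMod N) :
    modeCoeff (fun j => X j - Y j) n = modeCoeff X n - modeCoeff Y n := by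
  simp [modeCoeff_eq_sum, smul_sub, Finset.sum_sub_distrib]

theorem modeCoeff_map (T : E →L[ℂ] F) (X : ℤ → E) (n : ZMod N) :
    modeCoeff (fun j => T (X j)) n = T (modeCoeff X n) := by
  simp [modeCoeff_eq_sum]

theorem modeCoeff_real_smul (c : ℝ) (X : ℤ → E) (n : ZMod N) :
    modeCoeff (fun j => c • X j) n = c • modeCoeff X n := by
  simp only [modeCoeff_eq_sum, Finset.smul_sum]
  exact Finset.sum_congr rfl fun j _ => by rw [smul_comm c, smul_comm c]

theorem modeCoeff_smul_const (f : ℤ → ℂ) (x : E) (n : ZMod N) :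
    modeCoeff (fun j => f j • x) n = modeCoeff f n • x := by
  simp only [modeCoeff_eq_sum, smul_smul, ← Finset.sum_smul, smul_eq_mul]

theorem hasDerivWithinAt_modeCoeff {X : ℤ → ℝ → E} {X' : ℤ → E} {s : Set ℝ} {t : ℝ}
    (h : ∀ j, HasDerivWithinAt (X j) (X' j) s t) (n : ZMod N) :
    HasDerivWithinAt (fun r => modeCoeff (fun j => X j r) n) (modeCoeff X' n) s t := by
  simp only [modeCoeff_eq_sum]
  exact (HasDerivWithinAt.fun_sum fun (j : ZMod N) _ =>
    (h j.val).const_smul (ZMod.stdAddChar (-(j * n)))).const_smul ((N : ℂ)⁻¹)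

end ModeCoeff

/-! ### Discontinuous Galerkin solutions as a linear system -/

/-- A polynomial as an element of the cell space; zero if its degree exceeds `p`. -/
def toCell (p : ℕ) (P : ℂ[X]) : Cell p :=
  if h : P.natDegree ≤ p then ⟨P, mem_degreeLT_add_one.2 h⟩ else 0

theorem coe_toCell {p : ℕ} {P : ℂ[X]} (h : P.natDegree ≤ p) : (toCell p P : ℂ[X]) = P := by
  simp [toCell, h]

theorem toCell_sub {p : ℕ} {P Q : ℂ[X]} (hP : P.natDegree ≤ p) (hQ : Q.natDegree ≤ p) :
    toCell p (P - Q) = toCell p P - toCell p Q := by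
  ext1
  rw [Submodule.coe_sub, coe_toCell hP, coe_toCell hQ,
    coe_toCell ((natDegree_sub_le _ _).trans (max_le hP hQ))]

theorem hasDerivWithinAt_of_inner {V : Type*} [NormedAddCommGroup V] [InnerProductSpace ℂ V]
    [FiniteDimensional ℂ V] {y : ℝ → V} {y' : V} {s : Set ℝ} {t : ℝ}
    (h : ∀ v : V, HasDerivWithinAt (fun r => inner ℂ v (y r)) (inner ℂ v y') s t) :
    HasDerivWithinAt y y' s t := by
  have coordinates := HasDerivWithinAt.fun_sum (u := Finset.univ)
    fun i _ => (h (stdOrthonormalBasis ℂ V i)).smul_const (stdOrthonormalBasis ℂ V i)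
  simpa only [OrthonormalBasis.sum_repr'] using coordinates

section DGSolution

variable {p N : ℕ} {a h : ℝ} {U : ℤ → ℝ → ℂ[X]}

theorem IsDGSolution.hasDerivWithinAt (hU : IsDGSolution p a h N U) (j : ℤ) {t : ℝ} (ht : 0 ≤ t) :
    HasDerivWithinAt (fun s => toCell p (U j s))
      ((a / h) • (localOp p (toCell p (U j t)) + inflowOp p (toCell p (U (j - 1) t))))
      (Set.Ici 0) t := by
  refine hasDerivWithinAt_of_inner fun v => ?_
  have hv : (conjPoly (v : ℂ[X])).natDegree ≤ p := (natDegree_conjPoly_le _).trans v.natDegree_le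
  have inner_eq : ∀ s ∈ Set.Ici (0 : ℝ), inner ℂ v (toCell p (U j s)) =
      ∫ ξ in (-1 : ℝ)..1, (U j s).eval (ξ : ℂ) * (conjPoly (v : ℂ[X])).eval (ξ : ℂ) := by
    intro s hs
    rw [Cell.inner_def, coe_toCell (hU.natDegree_le j s hs), ← cellIntegral_mul, mul_comm]
  refine ((hU.weak_form j t ht _ hv).congr inner_eq (inner_eq t ht)).congr_deriv ?_
  rw [Cell.inner_def, mul_comm (conjPoly _), ← Complex.coe_smul, Submodule.coe_smul,
    Submodule.coe_add, smul_mul_assoc, map_smul, add_mul, map_add,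
    cellIntegral_localOp_mul p _ _ hv, cellIntegral_inflowOp_mul p _ _ hv,
    coe_toCell (hU.natDegree_le j t ht),
    coe_toCell (hU.natDegree_le (j - 1) t ht), ← cellIntegral_mul, smul_eq_mul]
  push_cast
  ring

theorem IsDGSolution.periodic_toCell (hU : IsDGSolution p a h N U) {t : ℝ} (ht : 0 ≤ t) :
    Function.Periodic (fun j => toCell p (U j t)) N :=
  fun j => congrArg (toCell p) (hU.periodic j t ht)

variable [NeZero N]

theorem IsDGSolution.modeCoeff_eq_flow (hU : IsDGSolution p a h N U) (n : ZMod N) {t : ℝ}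
    (ht : 0 ≤ t) : modeCoeff (fun j => toCell p (U j t)) n =
      flow (blochOp p (modeAngle n)) (a / h * t) (modeCoeff (fun j => toCell p (U j 0)) n) := by
  refine eq_flow_of_hasDerivWithinAt (y := fun s => modeCoeff (fun j => toCell p (U j s)) n)
    (fun s hs => ?_) ht
  refine (hasDerivWithinAt_modeCoeff (fun j => hU.hasDerivWithinAt j hs) n).congr_deriv ?_
  rw [modeCoeff_real_smul, modeCoeff_add, modeCoeff_map, modeCoeff_map,
    modeCoeff_shift (hU.periodic_toCell hs), stdAddChar_neg_eq_exp_modeAngle, map_smul]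
  rfl

theorem IsDGSolution.norm_toCell_advection_le (hU : IsDGSolution p a h N U) (ha : 0 < a)
    (hh : 0 < h) (j : ℤ) {t : ℝ} (ht : 0 ≤ t) :
    ‖toCell p (U (j + 1) (t + h / a)) - toCell p (U j t)‖ ≤ ∑ n : ZMod N,
      ‖flow (blochOp p (modeAngle n)) (a / h * t)
        (shiftDefect (blochOp p (modeAngle n)) (modeAngle n)
          (modeCoeff (fun j => toCell p (U j 0)) n))‖ := by
  have ht' : 0 ≤ t + h / a := by positivity
  have rescaled : a / h * (t + h / a) = a / h * t + 1 := by field_simp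
  rw [← sum_smul_modeCoeff (hU.periodic_toCell ht') (j + 1),
    ← sum_smul_modeCoeff (hU.periodic_toCell ht) j, ← Finset.sum_sub_distrib]
  refine norm_sum_le_of_le _ fun n _ => le_of_eq ?_
  rw [hU.modeCoeff_eq_flow n ht', hU.modeCoeff_eq_flow n ht, rescaled, flow_add_apply,
    Int.cast_add, Int.cast_one, add_mul, one_mul, AddChar.map_add_eq_mul, ← smul_smul, ← smul_sub,
    norm_smul, AddChar.norm_apply, one_mul, stdAddChar_eq_exp_modeAngle, shiftDefect_apply,
    map_sub, map_smul]

end DGSolution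

/-! ### Grid modes of projected smooth data -/

section FwdDiff

variable {u : ℝ → ℂ} {h L : ℝ}

theorem contDiff_natCast_of_smooth (hu : ContDiff ℝ ∞ u) (i : ℕ) : ContDiff ℝ i u :=
  hu.of_le (by exact_mod_cast le_top)

theorem contDiff_fwdDiff (h : ℝ) (hu : ContDiff ℝ ∞ u) : ContDiff ℝ ∞ (fwdDiff h u) :=
  (hu.comp (contDiff_id.add contDiff_const)).sub hu

theorem contDiff_iterate_fwdDiff (h : ℝ) (hu : ContDiff ℝ ∞ u) (m : ℕ) :
    ContDiff ℝ ∞ ((fwdDiff h)^[m] u) :=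
  Function.Iterate.rec (ContDiff ℝ ∞) hu (fun _ => contDiff_fwdDiff h) m

theorem periodic_fwdDiff (h : ℝ) (hu : Function.Periodic u L) :
    Function.Periodic (fwdDiff h u) L := fun x => by
  rw [fwdDiff, fwdDiff, hu x, add_right_comm, hu]

theorem periodic_iterate_fwdDiff (h : ℝ) (hu : Function.Periodic u L) (m : ℕ) :
    Function.Periodic ((fwdDiff h)^[m] u) L :=
  Function.Iterate.rec (Function.Periodic · L) hu (fun _ => periodic_fwdDiff h) m

theorem norm_iteratedDeriv_fwdDiff_le (hu : ContDiff ℝ ∞ u) {i : ℕ} {b : ℝ}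
    (hb : ∀ x, ‖iteratedDeriv (i + 1) u x‖ ≤ b) (x : ℝ) :
    ‖iteratedDeriv i (fwdDiff h u) x‖ ≤ |h| * b := by
  have diff_eq : fwdDiff h u = (fun z => u (z + h)) - u := rfl
  have shifted : ContDiff ℝ i fun z => u (z + h) :=
    (contDiff_natCast_of_smooth hu i).comp (contDiff_id.add contDiff_const)
  rw [diff_eq, iteratedDeriv_sub shifted.contDiffAt (contDiff_natCast_of_smooth hu i).contDiffAt,
    iteratedDeriv_comp_add_const]
  have mean_value := Convex.norm_image_sub_le_of_norm_deriv_le (𝕜 := ℝ) (f := iteratedDeriv i u)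
    (x := x) (y := x + h)
    (fun y _ => (hu.differentiable_iteratedDeriv i (by exact_mod_cast ENat.natCast_lt_top i)) y)
    (fun y _ => by rw [← iteratedDeriv_succ]; exact hb y) convex_univ trivial trivial
  rwa [add_sub_cancel_left, Real.norm_eq_abs, mul_comm] at mean_value

theorem norm_iteratedDeriv_iterate_fwdDiff_le (hu : ContDiff ℝ ∞ u) {i m : ℕ} {b : ℝ}
    (hb : ∀ x, ‖iteratedDeriv (i + m) u x‖ ≤ b) (x : ℝ) :
    ‖iteratedDeriv i ((fwdDiff h)^[m] u) x‖ ≤ |h| ^ m * b := by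
  induction m generalizing u b with
  | zero => simpa using hb x
  | succ m ih =>
    rw [Function.iterate_succ_apply, pow_succ, mul_assoc]
    exact ih (contDiff_fwdDiff h hu) fun y => norm_iteratedDeriv_fwdDiff_le hu hb y

theorem exists_norm_iteratedDeriv_le (hu : ContDiff ℝ ∞ u) (hL : L ≠ 0)
    (hper : Function.Periodic u L) (k : ℕ) :
    ∃ b : ℝ, 0 ≤ b ∧ ∀ i ≤ k, ∀ x, ‖iteratedDeriv i u x‖ ≤ b := by
  have bounded (i : ℕ) : ∃ b : ℝ, ∀ x, ‖iteratedDeriv i u x‖ ≤ b := by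
    have periodic : Function.Periodic (iteratedDeriv i u) L := fun x => by
      rw [← congrFun (iteratedDeriv_comp_add_const i u L) x, funext hper]
    obtain ⟨b, hb⟩ := (periodic.isBounded_of_continuous hL
      (hu.continuous_iteratedDeriv i (by exact_mod_cast le_top))).exists_norm_le
    exact ⟨b, fun x => hb _ ⟨x, rfl⟩⟩
  choose b hb using bounded
  have hb0 (i : ℕ) : 0 ≤ b i := (norm_nonneg _).trans (hb i 0)
  exact ⟨∑ i ∈ Finset.range (k + 1), b i, Finset.sum_nonneg fun i _ => hb0 i, fun i hi x =>
    (hb i x).trans (Finset.single_le_sum (fun i _ => hb0 i) (Finset.mem_range_succ_iff.2 hi))⟩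

end FwdDiff

section OnCell

variable {u : ℝ → ℂ} {x₀ h : ℝ}

theorem onCell_eq (u : ℝ → ℂ) (x₀ h : ℝ) (j : ℤ) :
    onCell u x₀ h j = fun ξ => u (x₀ + j * h + h / 2 + h / 2 * ξ) := by
  funext ξ
  rw [onCell]
  ring_nf

theorem contDiff_onCell (hu : ContDiff ℝ ∞ u) (x₀ h : ℝ) (j : ℤ) :
    ContDiff ℝ ∞ (onCell u x₀ h j) := by
  rw [onCell_eq]
  exact hu.comp (contDiff_const.add (contDiff_const.mul contDiff_id))

theorem onCell_fwdDiff (u : ℝ → ℂ) (x₀ h : ℝ) (j : ℤ) :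
    onCell (fwdDiff (-h) u) x₀ h j = fun ξ => onCell u x₀ h (j - 1) ξ - onCell u x₀ h j ξ := by
  funext ξ
  simp only [onCell, fwdDiff]
  push_cast
  ring_nf

theorem periodic_onCell {L : ℝ} (hu : Function.Periodic u L) (x₀ : ℝ) (N : ℕ) [NeZero N] :
    Function.Periodic (onCell u x₀ (L / N)) N := fun j => by
  funext ξ
  have hN : (N : ℝ) ≠ 0 := NeZero.ne _
  rw [onCell, onCell, ← hu (x₀ + j * (L / N) + L / N / 2 * (ξ + 1)), Int.cast_add,
    Int.cast_natCast, add_mul, mul_div_cancel₀ L hN]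
  ring_nf

theorem norm_iteratedDeriv_onCell_le (hu : ContDiff ℝ ∞ u) (hh : 0 ≤ h) {r i : ℕ} (hi : i ≤ r)
    {b : ℝ} (hb : ∀ x, ‖iteratedDeriv i u x‖ ≤ b) (j : ℤ) (ξ : ℝ) :
    ‖iteratedDeriv i (onCell u x₀ h j) ξ‖ ≤ (1 + h) ^ r * b := by
  have shifted : ContDiff ℝ i fun y => u (x₀ + j * h + h / 2 + y) :=
    (contDiff_natCast_of_smooth hu i).comp (contDiff_const.add contDiff_id)
  have scale_le : (h / 2) ^ i ≤ (1 + h) ^ r :=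
    (pow_le_pow_left₀ (by positivity) (by linarith) i).trans
      (pow_le_pow_right₀ (by linarith) hi)
  rw [onCell_eq, iteratedDeriv_comp_const_smul shifted (h / 2), iteratedDeriv_comp_const_add,
    norm_smul, norm_pow, Real.norm_of_nonneg (by positivity)]
  exact mul_le_mul scale_le (hb _) (norm_nonneg _) (by positivity)

end OnCell

/-- The data of `u` projected cell by cell, with the projection `Q`, on the mesh of size `h`. -/
def cellData (p : ℕ) (Q : (ℝ → ℂ) → ℂ[X]) (u : ℝ → ℂ) (x₀ h : ℝ) (j : ℤ) : Cell p :=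
  toCell p (Q (onCell u x₀ h j))

section CellData

variable {p r : ℕ} {B : ℝ} {Q : (ℝ → ℂ) → ℂ[X]} {u : ℝ → ℂ} {L : ℝ}

theorem IsCellProjection.map_sub (hQ : IsCellProjection p r B Q) {v w : ℝ → ℂ}
    (hv : ContDiff ℝ ∞ v) (hw : ContDiff ℝ ∞ w) : Q (fun ξ => v ξ - w ξ) = Q v - Q w := by
  have add_neg := hQ.map_add v (fun ξ => (-1) * w ξ) hv (contDiff_const.mul hw)
  rw [hQ.map_smul (-1) w hw] at add_neg
  simpa only [neg_one_mul, ← sub_eq_add_neg, C_neg, C_1] using add_neg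

theorem IsCellProjection.mono (hQ : IsCellProjection p r B Q) {B' : ℝ} (h : B ≤ B') :
    IsCellProjection p r B' Q where
  __ := hQ
  bound v hv b hb ξ hξ := (hQ.bound v hv b hb ξ hξ).trans
    (mul_le_mul_of_nonneg_right h ((norm_nonneg _).trans (hb 0 (Nat.zero_le _) ξ hξ)))

theorem IsCellProjection.sub_eval (hQ : IsCellProjection p r B Q) :
    IsCellProjection p r (B + 1) fun v => Q v - C (v (-1)) where
  natDegree_le v hv := (natDegree_sub_le _ _).trans (max_le (hQ.natDegree_le v hv) (by simp))
  map_add v w hv hw := by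
    rw [hQ.map_add v w hv hw, C_add]
    ring
  map_smul c v hv := by
    rw [hQ.map_smul c v hv, C_mul]
    ring
  bound v hv b hb ξ hξ := by
    have left_value : ‖v (-1)‖ ≤ b := by simpa using hb 0 (Nat.zero_le _) (-1) (by simp)
    rw [eval_sub, eval_C, add_mul, one_mul]
    exact (norm_sub_le _ _).trans (add_le_add (hQ.bound v hv b hb ξ hξ) left_value)

theorem IsCellProjection.norm_cellData_le (hQ : IsCellProjection p r B Q) (hu : ContDiff ℝ ∞ u)
    (x₀ : ℝ) {h : ℝ} (hh : 0 ≤ h) {b : ℝ} (hb : ∀ i ≤ r, ∀ x, ‖iteratedDeriv i u x‖ ≤ b) (j : ℤ) :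
    ‖cellData p Q u x₀ h j‖ ≤ 2 * (B * ((1 + h) ^ r * b)) := by
  have smooth := contDiff_onCell hu x₀ h j
  refine Cell.norm_le_of_forall_eval _ fun ξ hξ => ?_
  rw [cellData, coe_toCell (hQ.natDegree_le _ smooth)]
  exact hQ.bound _ smooth _
    (fun i hi ξ _ => norm_iteratedDeriv_onCell_le hu hh hi (hb i hi) j ξ) ξ hξ

theorem periodic_cellData (hu : Function.Periodic u L) (x₀ : ℝ) (N : ℕ) [NeZero N] :
    Function.Periodic (cellData p Q u x₀ (L / N)) N := fun j =>
  congrArg (fun v => toCell p (Q v)) (periodic_onCell hu x₀ N j)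

theorem IsCellProjection.cellData_fwdDiff (hQ : IsCellProjection p r B Q) (hu : ContDiff ℝ ∞ u)
    (x₀ h : ℝ) (j : ℤ) : cellData p Q (fwdDiff (-h) u) x₀ h j =
      cellData p Q u x₀ h (j - 1) - cellData p Q u x₀ h j := by
  have smooth := contDiff_onCell hu x₀ h
  rw [cellData, onCell_fwdDiff, hQ.map_sub (smooth _) (smooth _),
    toCell_sub (hQ.natDegree_le _ (smooth _)) (hQ.natDegree_le _ (smooth _)), cellData, cellData]

theorem IsCellProjection.modeCoeff_iterate_fwdDiff (hQ : IsCellProjection p r B Q)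
    (hu : ContDiff ℝ ∞ u) (hper : Function.Periodic u L) (x₀ : ℝ) {N : ℕ} [NeZero N] (n : ZMod N)
    (m : ℕ) : modeCoeff (cellData p Q ((fwdDiff (-(L / N)))^[m] u) x₀ (L / N)) n =
      ((ZMod.stdAddChar (-n) : ℂ) - 1) ^ m • modeCoeff (cellData p Q u x₀ (L / N)) n := by
  induction m with
  | zero => simp
  | succ m ih =>
    rw [Function.iterate_succ_apply',
      funext (hQ.cellData_fwdDiff (contDiff_iterate_fwdDiff _ hu m) x₀ (L / N)), modeCoeff_sub,
      modeCoeff_shift (periodic_cellData (periodic_iterate_fwdDiff _ hper m) x₀ N), ih]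
    module

end CellData

theorem exists_pow_mul_norm_modeCoeff_cellData_le (p r : ℕ) {u : ℝ → ℂ} (hu : ContDiff ℝ ∞ u)
    {L : ℝ} (hL : 0 < L) (hper : Function.Periodic u L) (x₀ : ℝ) (m : ℕ) :
    ∃ K : ℝ, 0 ≤ K ∧ ∀ (N : ℕ) [NeZero N] (B : ℝ) (Q : (ℝ → ℂ) → ℂ[X]), 0 ≤ B →
      IsCellProjection p r B Q → ∀ n : ZMod N,
        |(n.valMinAbs : ℝ)| ^ m * ‖modeCoeff (cellData p Q u x₀ (L / N)) n‖ ≤ K * B := by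
  obtain ⟨b, hb0, hb⟩ := exists_norm_iteratedDeriv_le hu hL.ne' hper (r + m)
  refine ⟨2 * ((1 + L) ^ r * b) * (L / 4) ^ m, by positivity, fun N _ B Q hB hQ n => ?_⟩
  have hN : (1 : ℝ) ≤ N := by exact_mod_cast NeZero.one_le
  have hh : 0 ≤ L / N := by positivity
  have hhL : L / N ≤ L := div_le_self hL.le hN
  have differenced : ‖modeCoeff (cellData p Q ((fwdDiff (-(L / N)))^[m] u) x₀ (L / N)) n‖ ≤
      2 * (B * ((1 + L / N) ^ r * ((L / N) ^ m * b))) := by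
    refine norm_modeCoeff_le (hQ.norm_cellData_le (contDiff_iterate_fwdDiff _ hu m) x₀ hh
      fun i hi x => ?_) n
    simpa only [abs_neg, abs_of_nonneg hh] using norm_iteratedDeriv_iterate_fwdDiff_le
      (h := -(L / N)) hu (hb (i + m) (Nat.add_le_add_right hi m)) x
  rw [hQ.modeCoeff_iterate_fwdDiff hu hper, norm_smul, norm_pow] at differenced
  calc |(n.valMinAbs : ℝ)| ^ m * ‖modeCoeff (cellData p Q u x₀ (L / N)) n‖
      = (N / 4) ^ m * ((4 * |(n.valMinAbs : ℝ)| / N) ^ m *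
          ‖modeCoeff (cellData p Q u x₀ (L / N)) n‖) := by
        rw [← mul_assoc, ← mul_pow]
        field_simp
    _ ≤ (N / 4) ^ m * (‖(ZMod.stdAddChar (-n) : ℂ) - 1‖ ^ m *
          ‖modeCoeff (cellData p Q u x₀ (L / N)) n‖) := by
        gcongr
        exact le_norm_stdAddChar_neg_sub_one n
    _ ≤ (N / 4) ^ m * (2 * (B * ((1 + L) ^ r * ((L / N) ^ m * b)))) := by
        refine mul_le_mul_of_nonneg_left (differenced.trans ?_) (by positivity)
        gcongr
    _ = 2 * ((1 + L) ^ r * b) * (N / 4 * (L / N)) ^ m * B := by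
        rw [mul_pow]
        ring
    _ = 2 * ((1 + L) ^ r * b) * (L / 4) ^ m * B := by field_simp

/-! ### The initial data -/

theorem norm_onCell_sub_onCell_neg_one_le {u : ℝ → ℂ} (hu : ContDiff ℝ ∞ u) {b : ℝ}
    (hb : ∀ x, ‖iteratedDeriv 1 u x‖ ≤ b) (x₀ : ℝ) {h : ℝ} (hh : 0 ≤ h) (j : ℤ) {ξ : ℝ}
    (hξ : ξ ∈ Set.Icc (-1 : ℝ) 1) : ‖onCell u x₀ h j ξ - onCell u x₀ h j (-1)‖ ≤ b * h := by
  have mean_value := Convex.norm_image_sub_le_of_norm_deriv_le (𝕜 := ℝ) (f := u)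
    (x := x₀ + j * h + h / 2 * (-1 + 1)) (y := x₀ + j * h + h / 2 * (ξ + 1))
    (fun y _ => hu.differentiable (by simp) y)
    (fun y _ => by rw [← iteratedDeriv_one]; exact hb y) convex_univ trivial trivial
  have step : |h / 2 * (ξ + 1)| ≤ h := by
    rw [abs_of_nonneg (mul_nonneg (by positivity) (by linarith [hξ.1]))]
    nlinarith [hξ.2]
  have hb0 : 0 ≤ b := (norm_nonneg _).trans (hb 0)
  refine mean_value.trans (mul_le_mul_of_nonneg_left ?_ hb0)
  rwa [neg_add_cancel, mul_zero, add_zero, add_sub_cancel_left]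

theorem norm_integral_onCell_sub_mul_le {u : ℝ → ℂ} (hu : ContDiff ℝ ∞ u) {b : ℝ}
    (hb : ∀ x, ‖iteratedDeriv 1 u x‖ ≤ b) (x₀ : ℝ) {h : ℝ} (hh : 0 ≤ h) (j : ℤ) {P : ℂ[X]} {c : ℝ}
    (hc : ∀ ξ ∈ Set.Icc (-1 : ℝ) 1, ‖P.eval (ξ : ℂ)‖ ≤ c) :
    ‖∫ ξ in (-1 : ℝ)..1, (onCell u x₀ h j ξ - onCell u x₀ h j (-1)) * P.eval (ξ : ℂ)‖ ≤
      2 * b * c * h := by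
  have hb0 : 0 ≤ b := (norm_nonneg _).trans (hb 0)
  calc _ ≤ b * h * c * |1 - (-1)| :=
        intervalIntegral.norm_integral_le_of_norm_le_const fun ξ hξ => by
          rw [Set.uIoc_of_le (by norm_num)] at hξ
          have hξ' := Set.Ioc_subset_Icc_self hξ
          rw [norm_mul]
          exact mul_le_mul (norm_onCell_sub_onCell_neg_one_le hu hb x₀ hh j hξ') (hc ξ hξ')
            (norm_nonneg _) (by positivity)
    _ = 2 * b * c * h := by
        norm_num
        ring

theorem exists_norm_eval_legendre_le (p : ℕ) : ∃ c : ℝ, 0 ≤ c ∧ ∀ k ≤ p,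
    ∀ ξ ∈ Set.Icc (-1 : ℝ) 1, ‖(legendre k).eval (ξ : ℂ)‖ ≤ c := by
  have bounded (k : ℕ) : ∃ c : ℝ, ∀ ξ ∈ Set.Icc (-1 : ℝ) 1, ‖(legendre k).eval (ξ : ℂ)‖ ≤ c :=
    isCompact_Icc.exists_bound_of_continuousOn (continuous_eval_ofReal (legendre k)).continuousOn
  choose c hc using bounded
  have hc0 (k : ℕ) : 0 ≤ c k := (norm_nonneg _).trans (hc k 0 (by simp))
  exact ⟨∑ k ∈ Finset.range (p + 1), c k, Finset.sum_nonneg fun k _ => hc0 k, fun k hk ξ hξ =>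
    (hc k ξ hξ).trans (Finset.single_le_sum (fun k _ => hc0 k) (Finset.mem_range_succ_iff.2 hk))⟩

theorem exists_norm_toCell_sub_eval_le (p : ℕ) {u : ℝ → ℂ} (hu : ContDiff ℝ ∞ u) {L : ℝ}
    (hL : L ≠ 0) (hper : Function.Periodic u L) (x₀ C₀ : ℝ) :
    ∃ K : ℝ, 0 ≤ K ∧ ∀ h : ℝ, 0 ≤ h → ∀ (j : ℤ) (P : ℂ[X]), P.natDegree ≤ p →
      (∀ k ≤ p, ‖∫ ξ in (-1 : ℝ)..1, (P.eval (ξ : ℂ) - onCell u x₀ h j ξ)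
        * (legendre k).eval (ξ : ℂ)‖ ≤ C₀ * h) →
      ‖toCell p (P - C (onCell u x₀ h j (-1)))‖ ≤ K * h := by
  obtain ⟨b, hb0, hb⟩ := exists_norm_iteratedDeriv_le hu hL hper 1
  obtain ⟨c, hc0, hc⟩ := exists_norm_eval_legendre_le p
  obtain ⟨d, hd0, hd⟩ := Cell.exists_norm_le_of_legendre_moments p
  refine ⟨d * (|C₀| + 2 * b * c), by positivity, fun h hh j P hP moments => ?_⟩
  rw [mul_assoc]
  refine hd _ _ fun k hk => ?_
  have data_cont : Continuous (onCell u x₀ h j) := (contDiff_onCell hu x₀ h j).continuous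
  have := continuous_eval_ofReal P
  have := continuous_eval_ofReal (legendre k)
  have split : ∫ ξ in (-1 : ℝ)..1, (P - C (onCell u x₀ h j (-1))).eval (ξ : ℂ) *
        (legendre k).eval (ξ : ℂ) =
      (∫ ξ in (-1 : ℝ)..1, (P.eval (ξ : ℂ) - onCell u x₀ h j ξ) * (legendre k).eval (ξ : ℂ)) +
      ∫ ξ in (-1 : ℝ)..1, (onCell u x₀ h j ξ - onCell u x₀ h j (-1)) *
        (legendre k).eval (ξ : ℂ) := by
    rw [← intervalIntegral.integral_add (Continuous.intervalIntegrable (by fun_prop) _ _)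
      (Continuous.intervalIntegrable (by fun_prop) _ _)]
    simp only [eval_sub, eval_C, ← add_mul, sub_add_sub_cancel]
  rw [coe_toCell ((natDegree_sub_le _ _).trans (max_le hP (by simp))), cellIntegral_mul, split,
    add_mul]
  exact (norm_add_le _ _).trans (add_le_add
    ((moments k hk).trans (mul_le_mul_of_nonneg_right (le_abs_self C₀) hh))
    (norm_integral_onCell_sub_mul_le hu (hb 1 le_rfl) x₀ hh j (hc k hk)))

/-! ### Summation over the grid modes -/

theorem exists_pow_mul_le_sqrt (s : ℕ) (K₀ : ℝ) (Km : ℕ → ℝ) (k : ℕ) :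
    ∃ K : ℝ, 0 ≤ K ∧ ∀ N d A : ℝ, 1 ≤ N → 0 ≤ d → 0 ≤ A → A ≤ K₀ →
      (∀ m, d ^ m * A ≤ Km m * N ^ s) → d ^ k * A ≤ K * √N := by
  let q := 2 * s + 1
  let K := max 1 (Km (k * q) * K₀ ^ (2 * s))
  refine ⟨K, by positivity, fun N d A hN hd hA hAK decay => ?_⟩
  have pow_le_sqrt_pow : N ^ s ≤ √N ^ q := by
    rw [pow_succ, pow_mul, Real.sq_sqrt (by positivity)]
    exact le_mul_of_one_le_right (by positivity) (Real.one_le_sqrt.2 hN)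
  -- Interpolation: the `q`-th power of `d ^ k * A` has a single factor `d ^ (k * q) * A`, which
  -- costs `N ^ s`; the root divides this exponent by `q > 2 * s`.
  refine le_of_pow_le_pow_left₀ (n := q) (by omega) (by positivity) ?_
  calc (d ^ k * A) ^ q = d ^ (k * q) * A * A ^ (2 * s) := by
        rw [mul_pow, ← pow_mul]
        ring
    _ ≤ Km (k * q) * N ^ s * K₀ ^ (2 * s) :=
        mul_le_mul (decay _) (pow_le_pow_left₀ hA hAK _) (by positivity)
          (le_trans (by positivity) (decay _))
    _ = Km (k * q) * K₀ ^ (2 * s) * N ^ s := by ring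
    _ ≤ K * N ^ s := by
        gcongr
        exact le_max_right _ _
    _ ≤ K ^ q * √N ^ q := by
        gcongr
        exact le_self_pow₀ (le_max_left _ _) (by omega)
    _ = (K * √N) ^ q := (mul_pow _ _ _).symm

theorem exists_sum_inv_one_add_sq_valMinAbs_le : ∃ S : ℝ, 0 ≤ S ∧ ∀ (N : ℕ) [NeZero N],
    ∑ n : ZMod N, (1 + |(n.valMinAbs : ℝ)| ^ 2)⁻¹ ≤ S := by
  have summable : Summable fun m : ℤ => (1 + |(m : ℝ)| ^ 2)⁻¹ := by
    refine Summable.of_norm_bounded_eventually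
      (Real.summable_one_div_int_pow.2 (by norm_num : 1 < 2)) ?_
    filter_upwards [(Set.finite_singleton (0 : ℤ)).compl_mem_cofinite] with m hm
    have hm0 : (m : ℝ) ≠ 0 := by exact_mod_cast hm
    rw [sq_abs, Real.norm_of_nonneg (by positivity), one_div]
    exact inv_anti₀ (by positivity) (by linarith)
  refine ⟨∑' m : ℤ, (1 + |(m : ℝ)| ^ 2)⁻¹, tsum_nonneg fun m => by positivity, fun N _ => ?_⟩
  have partial_sum := summable.sum_le_tsum
    (Finset.univ.map ⟨ZMod.valMinAbs (n := N), ZMod.injective_valMinAbs⟩)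
    (fun m _ => by positivity)
  rwa [Finset.sum_map] at partial_sum

theorem exists_sum_pow_mul_le_sqrt (s : ℕ) (K₀ : ℝ) (Km : ℕ → ℝ) (k : ℕ) :
    ∃ K : ℝ, 0 ≤ K ∧ ∀ (N : ℕ) [NeZero N] (A : ZMod N → ℝ), (∀ n, 0 ≤ A n) → (∀ n, A n ≤ K₀) →
      (∀ m n, |(n.valMinAbs : ℝ)| ^ m * A n ≤ Km m * N ^ s) →
      ∑ n : ZMod N, |(n.valMinAbs : ℝ)| ^ k * A n ≤ K * √N := by
  obtain ⟨S, hS, sum_le⟩ := exists_sum_inv_one_add_sq_valMinAbs_le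
  obtain ⟨K₁, hK₁, bound⟩ := exists_pow_mul_le_sqrt s K₀ Km k
  obtain ⟨K₂, hK₂, bound_add_two⟩ := exists_pow_mul_le_sqrt s K₀ Km (k + 2)
  refine ⟨(K₁ + K₂) * S, by positivity, fun N _ A hA hAK decay => ?_⟩
  have hN : (1 : ℝ) ≤ N := by exact_mod_cast NeZero.one_le
  have term_le (n : ZMod N) : |(n.valMinAbs : ℝ)| ^ k * A n ≤
      (K₁ + K₂) * √N * (1 + |(n.valMinAbs : ℝ)| ^ 2)⁻¹ := by
    have hd := abs_nonneg (n.valMinAbs : ℝ)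
    rw [le_mul_inv_iff₀ (by positivity), mul_add, mul_one, mul_right_comm, ← pow_add, add_mul]
    exact add_le_add (bound N _ _ hN hd (hA n) (hAK n) (decay · n))
      (bound_add_two N _ _ hN hd (hA n) (hAK n) (decay · n))
  calc _ ≤ ∑ n : ZMod N, (K₁ + K₂) * √N * (1 + |(n.valMinAbs : ℝ)| ^ 2)⁻¹ :=
        Finset.sum_le_sum fun n _ => term_le n
    _ ≤ (K₁ + K₂) * √N * S := by
        rw [← Finset.mul_sum]
        gcongr
        exact sum_le N
    _ = (K₁ + K₂) * S * √N := mul_right_comm _ _ _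

theorem exists_sum_modeAngle_pow_mul_norm_modeCoeff_le (p r s : ℕ) {e k q : ℕ}
    (hq : k + e = q + 1) {u : ℝ → ℂ} (hu : ContDiff ℝ ∞ u) {L : ℝ} (hL : 0 < L)
    (hper : Function.Periodic u L) (x₀ K₀ : ℝ) {B : ℝ} (hB : 0 ≤ B) :
    ∃ K : ℝ, 0 ≤ K ∧ ∀ (N : ℕ) [NeZero N] (Q : (ℝ → ℂ) → ℂ[X]),
      IsCellProjection p r (B * N ^ s) Q → (∀ j, N ^ e * ‖cellData p Q u x₀ (L / N) j‖ ≤ K₀) →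
      ∑ n : ZMod N, |modeAngle n| ^ k * ‖modeCoeff (cellData p Q u x₀ (L / N)) n‖ ≤
        K * ((L / N) ^ q * √(L / N)) := by
  choose Km _ decay using exists_pow_mul_norm_modeCoeff_cellData_le p r hu hL hper x₀
  obtain ⟨K, hK, sum_le⟩ := exists_sum_pow_mul_le_sqrt (s + e) K₀ (fun m => Km m * B) k
  refine ⟨(2 * Real.pi) ^ k * K / (L ^ q * √L), by positivity, fun N _ Q hQ data_le => ?_⟩
  have hN : (0 : ℝ) < N := Nat.cast_pos.2 (NeZero.pos N)
  have : 0 < √L := Real.sqrt_pos.2 hL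
  let A (n : ZMod N) : ℝ := N ^ e * ‖modeCoeff (cellData p Q u x₀ (L / N)) n‖
  have A_le (n : ZMod N) : A n ≤ K₀ := by
    rw [← le_div_iff₀' (by positivity)]
    exact norm_modeCoeff_le (fun j => (le_div_iff₀' (by positivity)).2 (data_le j)) n
  have A_decay (m : ℕ) (n : ZMod N) :
      |(n.valMinAbs : ℝ)| ^ m * A n ≤ Km m * B * (N : ℝ) ^ (s + e) := by
    calc _ = N ^ e * (|(n.valMinAbs : ℝ)| ^ m * ‖modeCoeff (cellData p Q u x₀ (L / N)) n‖) :=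
          mul_left_comm _ _ _
      _ ≤ N ^ e * (Km m * (B * N ^ s)) :=
          mul_le_mul_of_nonneg_left (decay m N _ Q (by positivity) hQ n) (by positivity)
      _ = Km m * B * N ^ (s + e) := by ring
  calc _ = (2 * Real.pi) ^ k / N ^ (k + e) * ∑ n : ZMod N, |(n.valMinAbs : ℝ)| ^ k * A n := by
        rw [Finset.mul_sum]
        refine Finset.sum_congr rfl fun n _ => ?_
        rw [abs_modeAngle, div_pow, mul_pow, pow_add]
        simp only [A]
        field_simp
    _ ≤ (2 * Real.pi) ^ k / N ^ (k + e) * (K * √N) := by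
        gcongr
        exact sum_le N A (fun n => by positivity) A_le A_decay
    _ = (2 * Real.pi) ^ k * K / (L ^ q * √L) * ((L / N) ^ q * √(L / N)) := by
        rw [hq, Real.sqrt_div hL.le, div_pow]
        field_simp
        rw [Real.sq_sqrt hN.le]
        ring

theorem IsCellProjection.cellData_sub_eval {p r : ℕ} {B : ℝ} {Q : (ℝ → ℂ) → ℂ[X]}
    (hQ : IsCellProjection p r B Q) {u : ℝ → ℂ} (hu : ContDiff ℝ ∞ u) (x₀ h : ℝ) (j : ℤ) :
    cellData p (fun v => Q v - C (v (-1))) u x₀ h j =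
      cellData p Q u x₀ h j - onCell u x₀ h j (-1) • Cell.one p := by
  rw [cellData, toCell_sub (hQ.natDegree_le _ (contDiff_onCell hu x₀ h j)) (by simp), cellData,
    Cell.eq_smul_one (coe_toCell (by simp))]

theorem exp_neg_mul_sqrt_le {q : ℕ} (hq : q ≠ 0) {μ τ M h : ℝ} (hh : 0 < h)
    (hM : Real.exp (-(μ * τ)) ≤ M * h ^ q) :
    Real.exp (-(μ * (1 - 1 / (2 * q)) * τ)) * √h ≤ M ^ (1 - 1 / (2 * q) : ℝ) * h ^ q := by
  have hM0 : 0 ≤ M := nonneg_of_mul_nonneg_left ((Real.exp_pos _).le.trans hM) (by positivity)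
  have one_le : (1 : ℝ) ≤ q := by exact_mod_cast Nat.one_le_iff_ne_zero.2 hq
  have exponent_nonneg : 0 ≤ 1 - 1 / (2 * q : ℝ) := by
    rw [sub_nonneg, div_le_one (by positivity)]
    linarith
  calc _ = Real.exp (-(μ * τ)) ^ (1 - 1 / (2 * q) : ℝ) * √h := by
        rw [← Real.exp_mul]
        ring_nf
    _ ≤ (M * h ^ q) ^ (1 - 1 / (2 * q) : ℝ) * √h := by gcongr
    _ = M ^ (1 - 1 / (2 * q) : ℝ) * (h ^ (q * (1 - 1 / (2 * q)) : ℝ) * h ^ (1 / 2 : ℝ)) := by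
        rw [Real.mul_rpow hM0 (by positivity), ← Real.rpow_natCast_mul hh.le, Real.sqrt_eq_rpow,
          mul_assoc]
    _ = M ^ (1 - 1 / (2 * q) : ℝ) * h ^ q := by
        rw [← Real.rpow_add hh, ← Real.rpow_natCast h q]
        congr 2
        field_simp
        ring

section InitialData

variable {p r s : ℕ} {u : ℝ → ℂ} {L x₀ B κ : ℝ} {Q : ℕ → (ℝ → ℂ) → ℂ[X]}

theorem exists_norm_cellData_le (hu : ContDiff ℝ ∞ u) (hL : 0 < L) (hper : Function.Periodic u L)
    (hdata : ∀ (N : ℕ) [NeZero N] (j : ℤ), ‖cellData p (Q N) u x₀ (L / N) j -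
      onCell u x₀ (L / N) j (-1) • Cell.one p‖ ≤ κ * (L / N)) :
    ∃ K₀ : ℝ, ∀ (N : ℕ) [NeZero N] (j : ℤ), ‖cellData p (Q N) u x₀ (L / N) j‖ ≤ K₀ := by
  obtain ⟨b, -, hb⟩ := exists_norm_iteratedDeriv_le hu hL.ne' hper 0
  refine ⟨|κ| * L + b * ‖Cell.one p‖, fun N _ j => ?_⟩
  have hhL : L / N ≤ L := div_le_self hL.le (by exact_mod_cast NeZero.one_le)
  have left_value : ‖onCell u x₀ (L / N) j (-1)‖ ≤ b := by
    simpa [onCell] using hb 0 le_rfl (x₀ + j * (L / N))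
  calc ‖cellData p (Q N) u x₀ (L / N) j‖
      ≤ ‖cellData p (Q N) u x₀ (L / N) j - onCell u x₀ (L / N) j (-1) • Cell.one p‖ +
          ‖onCell u x₀ (L / N) j (-1) • Cell.one p‖ := norm_le_norm_sub_add _ _
    _ ≤ |κ| * L + b * ‖Cell.one p‖ := by
        rw [norm_smul]
        gcongr
        exact (hdata N j).trans
          (mul_le_mul (le_abs_self κ) hhL (by positivity) (abs_nonneg κ))

theorem exists_sum_norm_modeCoeff_sub_smul_one_le (hu : ContDiff ℝ ∞ u) (hL : 0 < L)
    (hper : Function.Periodic u L) (hB : 0 ≤ B)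
    (hQ : ∀ (N : ℕ) [NeZero N], IsCellProjection p r (B * N ^ s) (Q N))
    (hdata : ∀ (N : ℕ) [NeZero N] (j : ℤ), ‖cellData p (Q N) u x₀ (L / N) j -
      onCell u x₀ (L / N) j (-1) • Cell.one p‖ ≤ κ * (L / N)) :
    ∃ K : ℝ, 0 ≤ K ∧ ∀ (N : ℕ) [NeZero N], ∃ c : ZMod N → ℂ,
      ∑ n, ‖modeCoeff (cellData p (Q N) u x₀ (L / N)) n - c n • Cell.one p‖ ≤ K * √(L / N) := by
  obtain ⟨K, hK, sum_le⟩ := exists_sum_modeAngle_pow_mul_norm_modeCoeff_le p r s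
    (e := 1) (k := 0) (q := 0) rfl hu hL hper x₀ (κ * L) (add_nonneg hB zero_le_one)
  refine ⟨K, hK, fun N _ => ⟨modeCoeff fun j => onCell u x₀ (L / N) j (-1), ?_⟩⟩
  have one_le : (1 : ℝ) ≤ N := by exact_mod_cast NeZero.one_le
  have bound_le : B * (N : ℝ) ^ s + 1 ≤ (B + 1) * N ^ s := by
    rw [add_one_mul]
    gcongr
    exact one_le_pow₀ one_le
  have data_le (j : ℤ) :
      (N : ℝ) ^ 1 * ‖cellData p (fun v => Q N v - C (v (-1))) u x₀ (L / N) j‖ ≤ κ * L := by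
    rw [(hQ N).cellData_sub_eval hu, pow_one]
    calc _ ≤ N * (κ * (L / N)) := mul_le_mul_of_nonneg_left (hdata N j) (by positivity)
      _ = κ * L := by field_simp
  simpa only [funext ((hQ N).cellData_sub_eval hu x₀ (L / N)), modeCoeff_sub,
    modeCoeff_smul_const, pow_zero, one_mul] using
    sum_le N _ ((hQ N).sub_eval.mono bound_le) data_le

theorem exists_norm_toCell_advection_le {μ ν a : ℝ} (hν : 0 < ν) (hνμ : ν < μ)
    (hμ : ∀ z : ℂ, IsNonphysicalRoot p z → μ ≤ z.re) (ha : 0 < a) (hu : ContDiff ℝ ∞ u)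
    (hL : 0 < L) (hper : Function.Periodic u L) (hB : 0 ≤ B)
    (hQ : ∀ (N : ℕ) [NeZero N], IsCellProjection p r (B * N ^ s) (Q N))
    (hdata : ∀ (N : ℕ) [NeZero N] (j : ℤ), ‖cellData p (Q N) u x₀ (L / N) j -
      onCell u x₀ (L / N) j (-1) • Cell.one p‖ ≤ κ * (L / N)) :
    ∃ K : ℝ, 0 ≤ K ∧ ∀ (N : ℕ) [NeZero N] (U : ℤ → ℝ → ℂ[X]), IsDGSolution p a (L / N) N U →
      (∀ j, U j 0 = Q N (onCell u x₀ (L / N) j)) → ∀ t : ℝ, 0 ≤ t → ∀ j,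
      ‖toCell p (U (j + 1) (t + L / N / a)) - toCell p (U j t)‖ ≤
        K * ((L / N) ^ (2 * p + 1) + Real.exp (-(ν * (a / (L / N) * t)))) * √(L / N) := by
  obtain ⟨K₀, cell_le⟩ := exists_norm_cellData_le hu hL hper hdata
  obtain ⟨K₁, hK₁, sum_high_order⟩ := exists_sum_modeAngle_pow_mul_norm_modeCoeff_le p r s
    (e := 0) (k := 2 * p + 2) (q := 2 * p + 1) rfl hu hL hper x₀ K₀ hB
  obtain ⟨K₂, hK₂, sum_first_order⟩ := exists_sum_modeAngle_pow_mul_norm_modeCoeff_le p r s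
    (e := 0) (k := 1) (q := 0) rfl hu hL hper x₀ K₀ hB
  obtain ⟨K₃, hK₃, sum_const_order⟩ :=
    exists_sum_norm_modeCoeff_sub_smul_one_le hu hL hper hB hQ hdata
  obtain ⟨K, hK, mode_le⟩ := exists_norm_flow_blochOp_shiftDefect_le p hν hνμ hμ
  refine ⟨K * (K₁ + K₂ + K₃), by positivity, fun N _ U hU hU₀ t ht j => ?_⟩
  obtain ⟨c, const_order⟩ := sum_const_order N
  have hN : (0 : ℝ) < N := Nat.cast_pos.2 (NeZero.pos N)
  have hh : 0 < L / N := by positivity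
  have cell_le' (j : ℤ) : (N : ℝ) ^ 0 * ‖cellData p (Q N) u x₀ (L / N) j‖ ≤ K₀ := by
    simpa using cell_le N j
  have high_order := sum_high_order N (Q N) (hQ N) cell_le'
  have first_order := sum_first_order N (Q N) (hQ N) cell_le'
  simp only [pow_one, pow_zero, one_mul] at first_order
  have initial : (fun j => toCell p (U j 0)) = cellData p (Q N) u x₀ (L / N) :=
    funext fun j => congrArg (toCell p) (hU₀ j)
  have advection := hU.norm_toCell_advection_le ha hh j ht
  rw [initial] at advection
  set E := Real.exp (-(ν * (a / (L / N) * t)))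
  calc _ ≤ ∑ n : ZMod N, K * (|modeAngle n| ^ (2 * p + 2) *
          ‖modeCoeff (cellData p (Q N) u x₀ (L / N)) n‖ +
          E * (‖modeCoeff (cellData p (Q N) u x₀ (L / N)) n - c n • Cell.one p‖ +
            |modeAngle n| * ‖modeCoeff (cellData p (Q N) u x₀ (L / N)) n‖)) :=
        advection.trans (Finset.sum_le_sum fun n _ => mode_le _ _ (by positivity) _ (c n))
    _ ≤ K * (K₁ * ((L / N) ^ (2 * p + 1) * √(L / N)) + E * (K₃ * √(L / N) + K₂ * √(L / N))) := by
        rw [← Finset.mul_sum, Finset.sum_add_distrib, ← Finset.mul_sum, Finset.sum_add_distrib]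
        gcongr
    _ = K * (K₁ * (L / N) ^ (2 * p + 1) + (K₂ + K₃) * E) * √(L / N) := by ring
    _ ≤ K * ((K₁ + K₂ + K₃) * (L / N) ^ (2 * p + 1) + (K₁ + K₂ + K₃) * E) * √(L / N) := by
        gcongr <;> linarith
    _ = K * (K₁ + K₂ + K₃) * ((L / N) ^ (2 * p + 1) + E) * √(L / N) := by ring

theorem exists_norm_toCell_advection_le_of_exp_le {μ a : ℝ} (hμ0 : 0 < μ)
    (hμ : ∀ z : ℂ, IsNonphysicalRoot p z → μ ≤ z.re) (ha : 0 < a) (hu : ContDiff ℝ ∞ u)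
    (hL : 0 < L) (hper : Function.Periodic u L) (hB : 0 ≤ B)
    (hQ : ∀ (N : ℕ) [NeZero N], IsCellProjection p r (B * N ^ s) (Q N))
    (hdata : ∀ (N : ℕ) [NeZero N] (j : ℤ), ‖cellData p (Q N) u x₀ (L / N) j -
      onCell u x₀ (L / N) j (-1) • Cell.one p‖ ≤ κ * (L / N)) (M : ℝ) :
    ∃ K : ℝ, ∀ (N : ℕ) [NeZero N] (U : ℤ → ℝ → ℂ[X]), IsDGSolution p a (L / N) N U →
      (∀ j, U j 0 = Q N (onCell u x₀ (L / N) j)) → ∀ t : ℝ, 0 ≤ t →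
      Real.exp (-(a * μ * t / (L / N))) ≤ M * (L / N) ^ (2 * p + 1) → ∀ j,
      ‖toCell p (U (j + 1) (t + L / N / a)) - toCell p (U j t)‖ ≤ K * (L / N) ^ (2 * p + 1) := by
  -- The factor `√h` in the advection bound pays for the loss of rate from `μ` to `ν < μ`.
  let σ : ℝ := 1 - 1 / (2 * (2 * p + 1 : ℕ))
  have one_le : (1 : ℝ) ≤ (2 * p + 1 : ℕ) := by exact_mod_cast Nat.le_add_left 1 (2 * p)
  have σ_pos : 0 < σ := by
    rw [sub_pos, div_lt_one (by positivity)]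
    linarith
  have σ_lt_one : σ < 1 := sub_lt_self 1 (by positivity)
  obtain ⟨K, hK, advection_le⟩ := exists_norm_toCell_advection_le (mul_pos hμ0 σ_pos)
    (mul_lt_of_lt_one_right hμ0 σ_lt_one) hμ ha hu hL hper hB hQ hdata
  refine ⟨K * (√L + M ^ σ), fun N _ U hU hU₀ t ht damped j => ?_⟩
  have hN : (1 : ℝ) ≤ N := by exact_mod_cast NeZero.one_le
  have hh : 0 < L / N := by positivity
  have decay : Real.exp (-(μ * σ * (a / (L / N) * t))) * √(L / N) ≤
      M ^ σ * (L / N) ^ (2 * p + 1) := by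
    refine exp_neg_mul_sqrt_le (Nat.succ_ne_zero _) hh (le_of_eq_of_le ?_ damped)
    ring_nf
  calc _ ≤ K * ((L / N) ^ (2 * p + 1) + Real.exp (-(μ * σ * (a / (L / N) * t)))) * √(L / N) :=
        advection_le N U hU hU₀ t ht j
    _ = K * ((L / N) ^ (2 * p + 1) * √(L / N) +
          Real.exp (-(μ * σ * (a / (L / N) * t))) * √(L / N)) := by ring
    _ ≤ K * ((L / N) ^ (2 * p + 1) * √L + M ^ σ * (L / N) ^ (2 * p + 1)) := by
        gcongr
        exact div_le_self hL.le hN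
    _ = K * (√L + M ^ σ) * (L / N) ^ (2 * p + 1) := by ring

end InitialData

theorem mul_pow_le_mul {C₀ h L : ℝ} (hh : 0 ≤ h) (hL : h ≤ L) {p k : ℕ} (hk : k ≤ p) :
    C₀ * h ^ (2 * p + 1 - k) ≤ |C₀| * (1 + L) ^ (2 * p) * h := by
  have split : 2 * p + 1 - k = 2 * p - k + 1 := by omega
  have pow_le : h ^ (2 * p - k) ≤ (1 + L) ^ (2 * p) :=
    (pow_le_pow_left₀ hh (by linarith) _).trans
      (pow_le_pow_right₀ (by linarith) (Nat.sub_le _ _))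
  rw [split, pow_succ, ← mul_assoc]
  exact mul_le_mul_of_nonneg_right
    (mul_le_mul (le_abs_self C₀) pow_le (by positivity) (abs_nonneg C₀)) hh

end DGAdvection

end

theorem corollary2_general {p : ℕ} {μ : ℝ} (hμ0 : 0 < μ)
    (hμ : ∀ z : ℂ, DGAdvection.IsNonphysicalRoot p z → μ ≤ z.re) {a L : ℝ} (x₀ : ℝ) (ha : 0 < a)
    (hL : 0 < L) {u₀ : ℝ → ℂ} (hu : ContDiff ℝ ∞ u₀) (hper : Function.Periodic u₀ L) {r s : ℕ}
    {B : ℝ} {Q : ℕ → (ℝ → ℂ) → Polynomial ℂ}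
    (hQ : ∀ N : ℕ, 1 ≤ N → DGAdvection.IsCellProjection p r (B * (N : ℝ) ^ s) (Q N))
    {U : ℕ → ℤ → ℝ → Polynomial ℂ}
    (hU : ∀ N : ℕ, 1 ≤ N → DGAdvection.IsDGSolution p a (L / N) N (U N))
    (hU₀ : ∀ N : ℕ, 1 ≤ N → ∀ j : ℤ, U N j 0 = Q N (DGAdvection.onCell u₀ x₀ (L / N) j)) {C₀ : ℝ}
    (moments : ∀ N : ℕ, 1 ≤ N → ∀ (j : ℤ) (k : ℕ), k ≤ p →
      ‖∫ ξ in (-1 : ℝ)..1, ((U N j 0).eval (ξ : ℂ) - DGAdvection.onCell u₀ x₀ (L / N) j ξ)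
        * (DGAdvection.legendre k).eval (ξ : ℂ)‖ ≤ C₀ * (L / N)) (M : ℝ) :
    ∃ K : ℝ, ∀ N : ℕ, 1 ≤ N → ∀ t : ℝ, 0 ≤ t →
      Real.exp (-(a * μ * t / (L / N))) ≤ M * (L / N) ^ (2 * p + 1) →
      ∀ j : ℤ, ∀ ξ ∈ Set.Icc (-1 : ℝ) 1,
        ‖(U N (j + 1) (t + L / N / a)).eval (ξ : ℂ) - (U N j t).eval (ξ : ℂ)‖
          ≤ K * (L / N) ^ (2 * p + 1) := by
  obtain ⟨κ, -, moment_bound⟩ :=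
    DGAdvection.exists_norm_toCell_sub_eval_le p hu hL.ne' hper x₀ C₀
  have hQ_abs (N : ℕ) [NeZero N] : DGAdvection.IsCellProjection p r (|B| * (N : ℝ) ^ s) (Q N) :=
    (hQ N NeZero.one_le).mono (mul_le_mul_of_nonneg_right (le_abs_self B) (by positivity))
  have initial_le (N : ℕ) [NeZero N] (j : ℤ) : ‖DGAdvection.cellData p (Q N) u₀ x₀ (L / N) j -
      DGAdvection.onCell u₀ x₀ (L / N) j (-1) • DGAdvection.Cell.one p‖ ≤ κ * (L / N) := by
    have hN : 1 ≤ N := NeZero.one_le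
    rw [← (hQ N hN).cellData_sub_eval hu]
    refine moment_bound _ (by positivity) j _
      ((hQ N hN).natDegree_le _ (DGAdvection.contDiff_onCell hu x₀ _ j)) fun k hk => ?_
    simpa only [hU₀ N hN] using moments N hN j k hk
  obtain ⟨K, advection_le⟩ := DGAdvection.exists_norm_toCell_advection_le_of_exp_le hμ0 hμ ha hu hL
    hper (abs_nonneg B) hQ_abs initial_le M
  obtain ⟨c, hc, eval_le⟩ := DGAdvection.Cell.exists_norm_eval_le p
  refine ⟨c * K, fun N hN t ht damped j ξ hξ => ?_⟩
  have : NeZero N := ⟨by omega⟩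
  rw [← DGAdvection.coe_toCell ((hU N hN).natDegree_le (j + 1) _ (by positivity)),
    ← DGAdvection.coe_toCell ((hU N hN).natDegree_le j t ht), ← Polynomial.eval_sub,
    ← Submodule.coe_sub, mul_assoc]
  exact (eval_le _ ξ hξ).trans (mul_le_mul_of_nonneg_left
    (advection_le N (U N) (hU N hN) (hU₀ N hN) t ht damped j) hc)

theorem corollary2 (p : ℕ) :
    (∀ z : ℂ, DGAdvection.IsNonphysicalRoot p z → 0 < z.re) ∧
    ∀ (μ : ℝ), 0 < μ → (∀ z : ℂ, DGAdvection.IsNonphysicalRoot p z → μ ≤ z.re) →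
    ∀ (a L x₀ : ℝ), 0 < a → 0 < L →
    -- a smooth periodic initial profile
    ∀ (u₀ : ℝ → ℂ), ContDiff ℝ ∞ u₀ → Function.Periodic u₀ L →
    -- for each `N ≥ 1`, one linear projection, used on every cell of the uniform mesh with `N`
    -- cells; its norm may grow polynomially in `N`
    ∀ (r s : ℕ) (B : ℝ) (Q : ℕ → (ℝ → ℂ) → Polynomial ℂ),
    (∀ N : ℕ, 1 ≤ N → DGAdvection.IsCellProjection p r (B * (N : ℝ) ^ s) (Q N)) →
    -- the numerical solutions, of mesh size `h = L / N`
    ∀ (U : ℕ → ℤ → ℝ → Polynomial ℂ),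
    (∀ N : ℕ, 1 ≤ N → DGAdvection.IsDGSolution p a (L / N) N (U N)) →
    (∀ N : ℕ, 1 ≤ N → ∀ j : ℤ, U N j 0 = Q N (DGAdvection.onCell u₀ x₀ (L / N) j)) →
    -- the moments of the initial error are of order `h ^ (2p+1-k)`
    (∃ C₀ : ℝ, ∀ N : ℕ, 1 ≤ N → ∀ (j : ℤ) (k : ℕ), k ≤ p →
      ‖∫ ξ in (-1 : ℝ)..1, ((U N j 0).eval (ξ : ℂ) - DGAdvection.onCell u₀ x₀ (L / N) j ξ)
        * (DGAdvection.legendre k).eval (ξ : ℂ)‖ ≤ C₀ * (L / N) ^ (2 * p + 1 - k)) →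
    -- once the non-physical modes are damped to order `h ^ (2p+1)`, advection has that accuracy
    ∀ M : ℝ, ∃ K : ℝ, ∀ N : ℕ, 1 ≤ N → ∀ t : ℝ, 0 ≤ t →
      Real.exp (-(a * μ * t / (L / N))) ≤ M * (L / N) ^ (2 * p + 1) →
      ∀ j : ℤ, ∀ ξ ∈ Set.Icc (-1 : ℝ) 1,
        ‖(U N (j + 1) (t + L / N / a)).eval (ξ : ℂ) - (U N j t).eval (ξ : ℂ)‖
          ≤ K * (L / N) ^ (2 * p + 1) := by
  refine ⟨fun z hz => hz.re_pos, fun μ hμ0 hμ a L x₀ ha hL u₀ hu hper r s B Q hQ U hU hU₀ hC₀ => ?_⟩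
  obtain ⟨C₀, hC₀⟩ := hC₀
  exact corollary2_general hμ0 hμ x₀ ha hL hu hper hQ hU hU₀ fun N hN j k hk =>
    (hC₀ N hN j k hk).trans
      (DGAdvection.mul_pow_le_mul (by positivity) (div_le_self hL.le (by exact_mod_cast hN)) hk)
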